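/- **Setting.** Let $M$ be a smooth ($C^\infty$) finite-dimensional Hausdorff manifold without boundary. $Simp(M)$ is the simplicial set whose $k$-simplices are the smooth maps $\sigma:\Delta^k\to M$ (maps extending smoothly to a neighbourhood of $\Delta^k$ in $\mathbb R^{k+1}$). A *graded vector bundle* $E=(E^i)_{i\in\mathbb Z}$ over $M$ is a family of smooth real vector bundles of finite rank. A *graded connection* on $E$ is an operator $D=d+A_0+A_1+A_2+\cdots$ of total degree $1$ on $E$-valued forms: its component of form degree $1$ is a smooth covariant derivative $\nabla=d+A_1$ on every $E^i$, and for $p\neq 1$, $A_p$ is a smooth $p$-form with values in the bundle of endomorphisms of degree $1-p$, i.e. in $\prod_i\mathrm{Hom}(E^i,E^{i+1-p})$. It is *flat* if $D^2=0$. (Ordinary flat degree-preserving connections are the case $A_p=0$ for $p\ne1$.) Let $I=[0,1]$. For $\sigma:\Delta^k\to M$ let $V_j$ be the graded fibre of $E$ at the image $\sigma(j)$ of the vertex $j$, and write $\partial_p\sigma$ for the $p$-th face and $\sigma|_{\langle 0,\dots,p\rangle}$, $\sigma|_{\langle p,\dots,k\rangle}$ for the front and back faces. A *representation up to homotopy*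 $\theta$ of $Simp(M)$ on $E$ assigns to each $k\ge 0$ and each $k$-simplex $\sigma$ a continuous map $\theta_k(\sigma): I^{k-1}\times V_k\to V_0$ (continuous on $I^{k-1}\times V_k^i$ in every degree $i$; for $k=0$ the cube is a point) such that * $\theta_0(\sigma)$ is the identity; * $\theta_k(\sigma)(t_1,\dots,t_{k-1},-):V_k\to V_0$ is a linear isomorphism of graded vector spaces for all $(t_1,\dots,t_{k-1})\in I^{k-1}$; * for $1\le p\le k-1$, if $t_p=0$ then $$\theta_k(\sigma)(t_1,\dots,t_{k-1},v)=\theta_{k-1}(\partial_p\sigma)(t_1,\dots,\widehat{t_p},\dots,t_{k-1},v);$$ * for $1\le p\le k-1$, if $t_p=1$ then $$\theta_k(\sigma)(t_1,\dots,t_{k-1},v)=\theta_p(\sigma|_{\langle 0,\dots,p\rangle})\bigl(t_1,\dots,t_{p-1},\theta_{k-p}(\sigma|_{\langle p,\dots,k\rangle})(t_{p+1},\dots,t_{k-1},v)\bigr).$$ A *compatible family of paths in simplices* is a family of maps $\gamma_k:I^{k-1}\to P\Delta^k$, $k\ge0$, where $P\Delta^k$ denotes the piecewise smooth Moore paths (paths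 parametrized by an interval $[0,\ell]$, $\ell\ge 0$) in $\Delta^k$, which is continuous (in the length and in the position jointly in $t$ and time), such that $\gamma_k(t)$ goes from the vertex $0$ to the vertex $k$, $\gamma_0$ is the trivial path, $\gamma_1$ is the identity path of $\Delta^1=[0,1]$, and for $1\le p\le k-1$: $\gamma_k(t)$ is $\gamma_{k-1}(t_1,\dots,\widehat{t_p},\dots,t_{k-1})$ in the $p$-th face of $\Delta^k$ if $t_p=0$, and is the concatenation of $\gamma_p(t_1,\dots,t_{p-1})$ in $\langle 0,\dots,p\rangle$ and $\gamma_{k-p}(t_{p+1},\dots,t_{k-1})$ in $\langle p,\dots,k\rangle$ if $t_p=1$. **Theorem.** There is a compatible family of paths $\gamma$ in simplices such that, for every $M$, every graded vector bundle $E\to M$ and every flat graded connection $D=d+A_0+A_1+\cdots$ on $E$, there is a representation up to homotopy $\theta$ of $Simp(M)$ on $E$ for which $\theta_k(\sigma)(t,-):V_k\to V_0$ is the $\nabla$-parallel transport, $\nabla=d+A_1$, along the path $\sigma\circ\gamma_k(t)$ (from its end to its start), for all $k$, $\sigma$ and $t\in I^{k-1}$. Moreover, the isomorphisms $\theta_k(\sigma)(t,-)$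 commute with the differentials $A_0$ of the fibres. -/

import Mathlib

open Bundle Set Topology CategoryTheory Opposite
open scoped Manifold ContDiff Simplicial

noncomputable section

/-! ### Smooth singular simplices -/

section Simp

variable (d : ℕ) (M : Type*) [TopologicalSpace M] [ChartedSpace (EuclideanSpace ℝ (Fin d)) M]

/-- A smooth singular `k`-simplex of the `d`-dimensional manifold `M`: a map `Δ^k → M` which
extends to a smooth map on an open neighbourhood of `Δ^k` in `ℝ^{k+1}`. -/
structure SmoothSimplex (k : ℕ) where
  toFun : stdSimplex ℝ (Fin (k + 1)) → M
  smooth : ∃ (U : Set (Fin (k + 1) → ℝ)) (f : (Fin (k + 1) → ℝ) → M),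
    IsOpen U ∧ stdSimplex ℝ (Fin (k + 1)) ⊆ U ∧
      ContMDiffOn 𝓘(ℝ, Fin (k + 1) → ℝ) (𝓡 d) ∞ f U ∧
      ∀ x : stdSimplex ℝ (Fin (k + 1)), f x = toFun x

variable {d M}

/-- The simplex `σ ∘ α_*`, where `α_* : Δ^m → Δ^k` is the affine map induced by the map of
vertices `α`. -/
def SmoothSimplex.pullback {k m : ℕ} (σ : SmoothSimplex d M k)
    (α : Fin (m + 1) →o Fin (k + 1)) : SmoothSimplex d M m where
  toFun x := σ.toFun (stdSimplex.map α x)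
  smooth := by
    obtain ⟨U, f, hU, hΔ, hf, hfσ⟩ := σ.smooth
    have hL : ContDiff ℝ ∞ (FunOnFinite.linearMap ℝ ℝ α) :=
      (LinearMap.toContinuousLinearMap (FunOnFinite.linearMap ℝ ℝ α)).contDiff
    refine ⟨FunOnFinite.linearMap ℝ ℝ α ⁻¹' U, f ∘ FunOnFinite.linearMap ℝ ℝ α,
      hU.preimage hL.continuous, ?_, ?_, ?_⟩
    · intro x hx
      exact hΔ (stdSimplex.image_linearMap (S := ℝ) α ⟨x, hx, rfl⟩)
    · exact hf.comp hL.contMDiff.contMDiffOn (fun x hx => hx)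
    · intro x
      exact hfσ (stdSimplex.map α x)

/-- The image of the `j`-th vertex of `Δ^k`. -/
def SmoothSimplex.vertex {k : ℕ} (σ : SmoothSimplex d M k) (j : Fin (k + 1)) : M :=
  σ.toFun (stdSimplex.vertex j)

theorem SmoothSimplex.vertex_pullback {k m : ℕ} (σ : SmoothSimplex d M k)
    (α : Fin (m + 1) →o Fin (k + 1)) (j : Fin (m + 1)) :
    (σ.pullback α).vertex j = σ.vertex (α j) := by
  simp only [vertex, pullback, stdSimplex.map_vertex]

theorem SmoothSimplex.pullback_id {k : ℕ} (σ : SmoothSimplex d M k) :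
    σ.pullback OrderHom.id = σ := by
  cases σ
  simp only [pullback, OrderHom.id_coe, stdSimplex.map_id_apply]

theorem SmoothSimplex.pullback_pullback {k m n : ℕ} (σ : SmoothSimplex d M k)
    (α : Fin (m + 1) →o Fin (k + 1)) (β : Fin (n + 1) →o Fin (m + 1)) :
    (σ.pullback α).pullback β = σ.pullback (α.comp β) := by
  simp only [pullback, stdSimplex.map_comp_apply]
  rfl

end Simp

/-- `Simp(M)`, the simplicial set of smooth singular simplices of the manifold `M`. -/
def Simp (d : ℕ) (M : Type*) [TopologicalSpace M]
    [ChartedSpace (EuclideanSpace ℝ (Fin d)) M] : SSet where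
  obj n := SmoothSimplex d M n.unop.len
  map f := ↾(fun σ => σ.pullback f.unop.toOrderHom)
  map_id n := by
    ext σ
    exact σ.pullback_id
  map_comp f g := by
    ext σ
    exact (σ.pullback_pullback _ _).symm

/-- The simplex of `Simp(M)` with vertices `α 0, …, α m` of a `k`-simplex `σ`. -/
def Simp.restrict {d : ℕ} {M : Type*} [TopologicalSpace M]
    [ChartedSpace (EuclideanSpace ℝ (Fin d)) M] {k m : ℕ} (α : Fin (m + 1) →o Fin (k + 1))
    (σ : (Simp d M).obj (op ⦋k⦌)) : (Simp d M).obj (op ⦋m⦌) :=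
  (Simp d M).map (SimplexCategory.mkHom α).op σ

/-- The point `σ(j) ∈ M`, for `j` a vertex of `Δ^k`. -/
def Simp.vertex {d : ℕ} {M : Type*} [TopologicalSpace M]
    [ChartedSpace (EuclideanSpace ℝ (Fin d)) M] {k : ℕ}
    (σ : (Simp d M).obj (op ⦋k⦌)) (j : Fin (k + 1)) : M :=
  SmoothSimplex.vertex (k := k) σ j

theorem Simp.vertex_restrict {d : ℕ} {M : Type*} [TopologicalSpace M]
    [ChartedSpace (EuclideanSpace ℝ (Fin d)) M] {k m : ℕ} (α : Fin (m + 1) →o Fin (k + 1))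
    (σ : (Simp d M).obj (op ⦋k⦌)) (j : Fin (m + 1)) :
    Simp.vertex (Simp.restrict α σ) j = Simp.vertex σ (α j) :=
  SmoothSimplex.vertex_pullback (k := k) σ α j

theorem Simp.vertex_restrict_eq {d : ℕ} {M : Type*} [TopologicalSpace M]
    [ChartedSpace (EuclideanSpace ℝ (Fin d)) M] {k m : ℕ} {α : Fin (m + 1) →o Fin (k + 1)}
    (σ : (Simp d M).obj (op ⦋k⦌)) {j : Fin (m + 1)} {i : Fin (k + 1)} (h : α j = i) :
    Simp.vertex (Simp.restrict α σ) j = Simp.vertex σ i := by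
  rw [Simp.vertex_restrict, h]

/-- The point `σ(x) ∈ M`, for `x ∈ Δ^k`. -/
def Simp.eval {d : ℕ} {M : Type*} [TopologicalSpace M]
    [ChartedSpace (EuclideanSpace ℝ (Fin d)) M] {k : ℕ}
    (σ : (Simp d M).obj (op ⦋k⦌)) (x : stdSimplex ℝ (Fin (k + 1))) : M :=
  SmoothSimplex.toFun (k := k) σ x

/-- The vertices of the `q`-th face `∂_q` of the standard `(k+1)`-simplex. -/
def faceMap {k : ℕ} (q : Fin (k + 2)) : Fin (k + 1) →o Fin (k + 2) :=
  (Fin.succAboveOrderEmb q).toOrderHom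

/-- The vertices `0, …, p` of the standard `(p+q)`-simplex, where `p = a + 1`, `q = b + 1`. -/
def frontMap (a b : ℕ) : Fin (a + 1 + 1) →o Fin (a + 1 + (b + 1) + 1) :=
  (Fin.castLEOrderEmb (by omega)).toOrderHom

/-- The vertices `p, …, p+q` of the standard `(p+q)`-simplex, where `p = a + 1`, `q = b + 1`. -/
def backMap (a b : ℕ) : Fin (b + 1 + 1) →o Fin (a + 1 + (b + 1) + 1) :=
  (Fin.natAddOrderEmb (a + 1)).toOrderHom

theorem frontMap_zero (a b : ℕ) : frontMap a b 0 = 0 := rfl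

theorem frontMap_last (a b : ℕ) : frontMap a b (Fin.last (a + 1)) = backMap a b 0 := rfl

theorem backMap_last (a b : ℕ) : backMap a b (Fin.last (b + 1)) = Fin.last _ := rfl

theorem restrict_faceMap {d : ℕ} {M : Type*} [TopologicalSpace M]
    [ChartedSpace (EuclideanSpace ℝ (Fin d)) M] {k : ℕ} (q : Fin (k + 2))
    (σ : (Simp d M).obj (op ⦋k + 1⦌)) :
    Simp.restrict (faceMap q) σ = (Simp d M).δ q σ := rfl

theorem faceMap_zero {k : ℕ} (p : Fin (k + 1)) : faceMap p.succ.castSucc 0 = 0 := rfl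

theorem faceMap_last {k : ℕ} (p : Fin (k + 1)) :
    faceMap p.succ.castSucc (Fin.last (k + 1)) = Fin.last _ := by
  simp [faceMap]

/-! ### Paths in simplices -/

/-- A piecewise smooth Moore path in `Δ^k`: a path `[0, length] → Δ^k`, extended to `ℝ` by
constants. -/
structure SimplexPath (k : ℕ) where
  length : ℝ
  length_nonneg : 0 ≤ length
  toFun : ℝ → stdSimplex ℝ (Fin (k + 1))
  eq_source : ∀ s ≤ 0, toFun s = toFun 0
  eq_target : ∀ s, length ≤ s → toFun s = toFun length
  continuous : Continuous toFun
  piecewise_smooth : ∃ S : Set ℝ, S.Finite ∧ ∀ a b : ℝ, a < b → Disjoint (Ioo a b) S →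
    ContDiffOn ℝ ∞ (fun s => (toFun s : Fin (k + 1) → ℝ)) (Icc a b)

/-- A realization of every simplex `Δ^k` as a family of paths `γ_k : I^{k-1} → PΔ^k` from the
vertex `0` to the vertex `k`, compatible with the face relations of the cubes: on `t_p = 0` the
path is the one of the `p`-th face, and on `t_p = 1` it is the concatenation of the paths of
the front `p`-face and of the back `(k-p)`-face. (The coordinates of a cube are indexed from
`0` here, so that the `p : Fin (n + 1)` below stands for the coordinate `p + 1`.) -/
structure SimplexPathFamily where
  path : ∀ k : ℕ, (Fin (k - 1) → unitInterval) → SimplexPath k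
  continuous_length : ∀ k, Continuous fun t => (path k t).length
  continuous_path : ∀ k, Continuous fun ts : (Fin (k - 1) → unitInterval) × ℝ =>
    (path k ts.1).toFun ts.2
  source : ∀ k t, (path k t).toFun 0 = stdSimplex.vertex 0
  target : ∀ k t, (path k t).toFun (path k t).length = stdSimplex.vertex (Fin.last k)
  /-- `γ_0` is the trivial path. -/
  point : ∀ t, (path 0 t).length = 0
  /-- `γ_1` is the identity path of `Δ^1 = [0, 1]`. -/
  edge : ∀ t, (path 1 t).length = 1 ∧ ∀ s ∈ Icc (0 : ℝ) 1, (path 1 t).toFun s 1 = s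
  face_zero : ∀ (n : ℕ) (p : Fin (n + 1)) (t : Fin (n + 1) → unitInterval), t p = 0 →
    (path (n + 2) t).length = (path (n + 1) (p.removeNth t)).length ∧
    ∀ s, (path (n + 2) t).toFun s =
      stdSimplex.map (faceMap p.succ.castSucc) ((path (n + 1) (p.removeNth t)).toFun s)
  face_one : ∀ (a b : ℕ) (t : Fin a → unitInterval) (t' : Fin b → unitInterval),
    let c := path (a + 1 + (b + 1)) (Fin.append (Fin.snoc t 1 : Fin (a + 1) → unitInterval) t')
    let c₁ := path (a + 1) t
    let c₂ := path (b + 1) t'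
    c.length = c₁.length + c₂.length ∧
    (∀ s ≤ c₁.length, c.toFun s = stdSimplex.map (frontMap a b) (c₁.toFun s)) ∧
    ∀ s ≥ c₁.length, c.toFun s = stdSimplex.map (backMap a b) (c₂.toFun (s - c₁.length))

/-! ### Graded vector bundles and graded connections

A graded vector bundle over `M` is a family `E = (E i)` of smooth vector bundles of finite rank
`E i → M`, indexed by the degree `i : ℤ`, with typical fibres `F i`. -/

section Local

variable {d : ℕ} {M : Type*} [TopologicalSpace M] [ChartedSpace (EuclideanSpace ℝ (Fin d)) M]
  [IsManifold (𝓡 d) ∞ M]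
  {F : Type*} [NormedAddCommGroup F] [NormedSpace ℝ F] [FiniteDimensional ℝ F]
  {E : M → Type*} [TopologicalSpace (TotalSpace F E)]
  [∀ x, AddCommGroup (E x)] [∀ x, Module ℝ (E x)] [∀ x, TopologicalSpace (E x)]
  [∀ x, IsTopologicalAddGroup (E x)] [∀ x, ContinuousSMul ℝ (E x)]
  [FiberBundle F E] [VectorBundle ℝ F E]

/-- The connection form `Γ` at `x` of a covariant derivative in the trivialization `e` of `E`
centred at `x₀`: `Γ(X)(v) = e(∇_X s_v)`, where `s_v = e⁻¹(·, v)` is the local section which is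
constant equal to `v` in the trivialization (for `v` in a basis of `F`, extended linearly). -/
def connectionForm (cov : CovariantDerivative (𝓡 d) F E) (x₀ x : M) :
    TangentSpace (𝓡 d) x →L[ℝ] F →L[ℝ] F :=
  ∑ a, (ContinuousLinearMap.smulRightL ℝ F F
      (LinearMap.toContinuousLinearMap ((Module.finBasis ℝ F).coord a))).comp
    (((trivializationAt F E x₀).continuousLinearMapAt ℝ x).comp
      (cov (fun y => (trivializationAt F E x₀).symm y (Module.finBasis ℝ F a)) x))

/-- `u` is a parallel lift to `E` of the curve `c` over `[a, b]`: it is continuous, and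
`∇_{c'} u = 0`, that is `u' + Γ(c') u = 0` in local trivializations, except at finitely many
points. -/
def IsParallelLift (cov : CovariantDerivative (𝓡 d) F E) (c : ℝ → M) (a b : ℝ)
    (u : ℝ → TotalSpace F E) : Prop :=
  (∀ s, (u s).proj = c s) ∧ ContinuousOn u (Icc a b) ∧
  ∃ S : Set ℝ, S.Finite ∧ ∀ s ∈ Ioo a b \ S, MDifferentiableAt 𝓘(ℝ, ℝ) (𝓡 d) c s ∧
    HasDerivAt (fun r => (trivializationAt F E (c s) (u r)).2)
      (-(connectionForm cov (c s) (c s) (mfderiv 𝓘(ℝ, ℝ) (𝓡 d) c s (1 : ℝ))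
        (trivializationAt F E (c s) (u s)).2)) s

/-- `P : E y → E x` is the (backward) parallel transport along the curve `c` over `[0, ℓ]` from
`x = c 0` to `y = c ℓ`: for every `v` in `E y` there is a parallel lift of `c` which ends at `v`
and starts at `P v`. -/
def IsParallelTransport (cov : CovariantDerivative (𝓡 d) F E) (c : ℝ → M) (ℓ : ℝ) {x y : M}
    (P : E y → E x) : Prop :=
  ∀ v : E y, ∃ u : ℝ → TotalSpace F E, IsParallelLift cov c 0 ℓ u ∧
    u 0 = ⟨x, P v⟩ ∧ u ℓ = ⟨y, v⟩

end Local

/-- The wedge product (with composition of operators) of an alternating `p`-form and an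
alternating `q`-form with values in spaces of operators, evaluated on `n = p + q` vectors,
normalized so that `(α ∧ β)(v₀, v₁) = α(v₀) β(v₁) - α(v₁) β(v₀)` for `1`-forms. -/
def wedgeApply {V G₁ G₂ G₃ : Type*} [NormedAddCommGroup V] [NormedSpace ℝ V]
    [NormedAddCommGroup G₁] [NormedSpace ℝ G₁] [NormedAddCommGroup G₂] [NormedSpace ℝ G₂]
    [NormedAddCommGroup G₃] [NormedSpace ℝ G₃] {p q n : ℕ} (h : p + q = n)
    (α : V [⋀^Fin p]→L[ℝ] (G₂ →L[ℝ] G₃)) (β : V [⋀^Fin q]→L[ℝ] (G₁ →L[ℝ] G₂))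
    (v : Fin n → V) : G₁ →L[ℝ] G₃ :=
  ((p.factorial * q.factorial : ℕ) : ℝ)⁻¹ • ∑ τ : Equiv.Perm (Fin n),
    ((Equiv.Perm.sign τ : ℤ) : ℝ) •
      (α fun k : Fin p => v (τ ⟨k, by omega⟩)).comp
        (β fun k : Fin q => v (τ ⟨p + k, by omega⟩))

section Graded

variable (d : ℕ) {M : Type*} [TopologicalSpace M] [ChartedSpace (EuclideanSpace ℝ (Fin d)) M]
  (F : ℤ → Type*) [∀ i, NormedAddCommGroup (F i)] [∀ i, NormedSpace ℝ (F i)]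
  (E : ℤ → M → Type*) [∀ i, TopologicalSpace (TotalSpace (F i) (E i))]
  [∀ i x, AddCommGroup (E i x)] [∀ i x, Module ℝ (E i x)] [∀ i x, TopologicalSpace (E i x)]
  [∀ i x, IsTopologicalAddGroup (E i x)] [∀ i x, ContinuousSMul ℝ (E i x)]
  [∀ i, FiberBundle (F i) (E i)] [∀ i, VectorBundle ℝ (F i) (E i)]

variable {E} in
/-- A form at the point of `M` with coordinates `y`, with values in the operators from `E i` to
`E j`, written in the chart and in the trivializations centred at `x₀`. -/
def localForm {p : ℕ} {i j : ℤ}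
    (A : ∀ x : M, TangentSpace (𝓡 d) x [⋀^Fin p]→L[ℝ] (E i x →L[ℝ] E j x)) (x₀ : M)
    (y : EuclideanSpace ℝ (Fin d)) :
    EuclideanSpace ℝ (Fin d) [⋀^Fin p]→L[ℝ] (F i →L[ℝ] F j) :=
  let x : M := (extChartAt (𝓡 d) x₀).symm y
  let dφ : EuclideanSpace ℝ (Fin d) →L[ℝ] TangentSpace (𝓡 d) x :=
    mfderiv 𝓘(ℝ, EuclideanSpace ℝ (Fin d)) (𝓡 d) (extChartAt (𝓡 d) x₀).symm y
  let L : (E i x →L[ℝ] E j x) →L[ℝ] (F i →L[ℝ] F j) :=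
    (((trivializationAt (F j) (E j) x₀).continuousLinearMapAt ℝ x).postcomp (F i)).comp
      (((trivializationAt (F i) (E i) x₀).symmL ℝ x).precomp (E j x))
  L.compContinuousAlternatingMap ((A x).compContinuousLinearMap dφ)

/-- A graded connection `d + A₀ + A₁ + A₂ + ⋯` (also called a `ℤ`-graded connection, or a
superconnection) of total degree `1` on the graded vector bundle `E`: its component of form
degree `1` is a smooth covariant derivative on each `E i`, and its component of form degree
`p ≠ 1` is a smooth `p`-form `A_p` with values in the operators of degree `1 - p` on `E`, given
by its components `form p i j` with values in `Hom(E i, E j)`. -/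
structure GradedConnection [IsManifold (𝓡 d) ∞ M] where
  cov : ∀ i, CovariantDerivative (𝓡 d) (F i) (E i)
  cov_smooth : ∀ i, CovariantDerivative.ContMDiffCovariantDerivative (cov i) ∞
  form : ∀ (p : ℕ) (i j : ℤ) (x : M), TangentSpace (𝓡 d) x [⋀^Fin p]→L[ℝ] (E i x →L[ℝ] E j x)
  form_one : ∀ i j x, form 1 i j x = 0
  form_degree : ∀ (p : ℕ) (i j : ℤ) (x : M), j ≠ i + 1 - p → form p i j x = 0
  form_smooth : ∀ (p : ℕ) (i j : ℤ) (x₀ : M),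
    ContDiffAt ℝ ∞ (localForm d F (form p i j) x₀) (extChartAt (𝓡 d) x₀ x₀)

namespace GradedConnection

variable {d F E} [IsManifold (𝓡 d) ∞ M] (D : GradedConnection d F E)

/-- The operator `A₀` on the fibre at `x`. -/
def differential (i : ℤ) (x : M) : E i x →L[ℝ] E (i + 1) x := D.form 0 i (i + 1) x ![]

variable [∀ i, FiniteDimensional ℝ (F i)]

/-- The component in `Ω^p(Hom(F i, F j))` of the local connection form `B` of `D` in the chart
and in the trivializations centred at `x₀`, for which `D = d + B`. -/
def localConnection (x₀ : M) (p : ℕ) (i j : ℤ) (y : EuclideanSpace ℝ (Fin d)) :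
    EuclideanSpace ℝ (Fin d) [⋀^Fin p]→L[ℝ] (F i →L[ℝ] F j) :=
  match p with
  | 0 => localForm d F (D.form 0 i j) x₀ y
  | 1 =>
    if h : i = j then
      ContinuousAlternatingMap.ofSubsingleton ℝ _ _ (0 : Fin 1)
        (h ▸ (connectionForm (D.cov i) x₀ ((extChartAt (𝓡 d) x₀).symm y)).comp
          (mfderiv 𝓘(ℝ, EuclideanSpace ℝ (Fin d)) (𝓡 d) (extChartAt (𝓡 d) x₀).symm y))
    else 0
  | p + 2 => localForm d F (D.form (p + 2) i j) x₀ y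

/-- The component in `Hom(F i, F j)` of `dB` in form degree `n` at `x₀`. -/
def dLocalConnection (x₀ : M) (n : ℕ) (i j : ℤ) (v : Fin n → EuclideanSpace ℝ (Fin d)) :
    F i →L[ℝ] F j :=
  match n with
  | 0 => 0
  | m + 1 => extDeriv (D.localConnection x₀ m i j) (extChartAt (𝓡 d) x₀ x₀) v

/-- The component in `Hom(F i, F (i + 2 - n))` of the curvature `D² = dB + B · B` in form degree
`n` at `x₀`, evaluated at the vectors `v`. For `α ∈ Ω^p` with values in operators of degree
`1 - p` and `β ∈ Ω^q`, the product is `α · β = (-1)^{(1-p)q} α ∧ β`. -/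
def curvature (x₀ : M) (n : ℕ) (i : ℤ) (v : Fin n → EuclideanSpace ℝ (Fin d)) :
    F i →L[ℝ] F (i + 2 - n) :=
  D.dLocalConnection x₀ n i (i + 2 - n) v +
  ∑ q : Fin (n + 1), (-1 : ℝ) ^ ((n - (q : ℕ) + 1) * (q : ℕ)) •
    wedgeApply (Nat.sub_add_cancel (Nat.le_of_lt_succ q.2))
      (D.localConnection x₀ (n - (q : ℕ)) (i + 1 - (q : ℕ)) (i + 2 - n)
        (extChartAt (𝓡 d) x₀ x₀))
      (D.localConnection x₀ (q : ℕ) i (i + 1 - (q : ℕ)) (extChartAt (𝓡 d) x₀ x₀)) v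

/-- `D` is flat: `D² = 0`. -/
def IsFlat : Prop := ∀ (x₀ : M) (n : ℕ) (i : ℤ) (v : Fin n → EuclideanSpace ℝ (Fin d)),
  D.curvature x₀ n i v = 0

end GradedConnection

/-! ### Representations up to homotopy -/

/-- The identification of the fibres at two equal points. -/
def fibreCast {X : Type*} {V : X → Type*} {x y : X} (h : x = y) (v : V x) : V y := h ▸ v

/-- A representation up to homotopy of `Simp(M)` on the graded vector bundle `E`: isomorphisms
of graded vector spaces `θ_k(σ)(t, -) : V_k → V_0`, depending continuously on `t ∈ I^{k-1}`,
where `V_j` is the fibre of `E` at the image of the vertex `j` under the `k`-simplex `σ`. (The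
coordinates of a cube are indexed from `0` here, so that the `p : Fin (n + 1)` in `face_zero`
stands for the coordinate `p + 1`; in `face_one`, the coordinate `p = a + 1` of the cube of
dimension `k - 1 = a + 1 + b` is equal to `1`.) -/
structure RepUpToHomotopy where
  θ : ∀ (k : ℕ) (σ : (Simp d M).obj (op ⦋k⦌)) (_ : Fin (k - 1) → unitInterval) (i : ℤ),
    E i (Simp.vertex σ (Fin.last k)) ≃L[ℝ] E i (Simp.vertex σ 0)
  continuous_θ : ∀ (k : ℕ) (σ : (Simp d M).obj (op ⦋k⦌)) (i : ℤ),
    Continuous fun tv : (Fin (k - 1) → unitInterval) × E i (Simp.vertex σ (Fin.last k)) =>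
      θ k σ tv.1 i tv.2
  point : ∀ (σ : (Simp d M).obj (op ⦋0⦌)) t i (v : E i (Simp.vertex σ 0)), θ 0 σ t i v = v
  face_zero : ∀ (n : ℕ) (σ : (Simp d M).obj (op ⦋n + 2⦌)) (p : Fin (n + 1))
    (t : Fin (n + 1) → unitInterval) (i : ℤ)
    (v : E i (Simp.vertex σ (Fin.last (n + 2)))), t p = 0 →
    θ (n + 2) σ t i v =
      fibreCast (Simp.vertex_restrict_eq σ (faceMap_zero p))
        (θ (n + 1) (Simp.restrict (faceMap p.succ.castSucc) σ) (p.removeNth t) i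
          (fibreCast (Simp.vertex_restrict_eq σ (faceMap_last p)).symm v))
  face_one : ∀ (a b : ℕ) (σ : (Simp d M).obj (op ⦋a + 1 + (b + 1)⦌))
    (t : Fin a → unitInterval) (t' : Fin b → unitInterval) (i : ℤ)
    (v : E i (Simp.vertex σ (Fin.last (a + 1 + (b + 1))))),
    θ (a + 1 + (b + 1)) σ (Fin.append (Fin.snoc t 1 : Fin (a + 1) → unitInterval) t') i v =
      fibreCast (Simp.vertex_restrict_eq σ (frontMap_zero a b))
        (θ (a + 1) (Simp.restrict (frontMap a b) σ) t i
          (fibreCast ((Simp.vertex_restrict_eq σ rfl).trans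
              (Simp.vertex_restrict_eq σ (frontMap_last a b)).symm)
            (θ (b + 1) (Simp.restrict (backMap a b) σ) t' i
              (fibreCast (Simp.vertex_restrict_eq σ (backMap_last a b)).symm v))))

end Graded

end

set_option linter.unnecessarySeqFocus false
set_option linter.unusedSectionVars false

noncomputable section

/-! ### Tail coordinates on the standard simplex -/

/-! A point of `Δ^{m+1}` is determined by its tail coordinates `y_j = ∑_{i ≥ j} x_i`, which satisfy
`1 = y_0 ≥ y_1 ≥ ⋯ ≥ y_{m+1} ≥ 0`. Write `T_j` for the sum of the first `j` entries of `t`. The path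
with parameter `t` lets `y_{j+1}` rise from 0 to 1 at unit speed during `[T_j, T_j + 1]`
(`cubePath`). Counting entries from 1: if `t_p = 0`, then `y_p = y_{p+1}` throughout, so the path
stays in the face `x_p = 0`; if `t_p = 1`, then `y_{p+1}` starts to rise exactly when `y_p` reaches
1, so the path passes through the vertex `p` and splits there.

Now `θ` is parallel transport along `σ ∘ γ_k(t)`. The face conditions hold because the curves agree
and because parallel lifts over a concatenation can be glued (`IsParallelLift.glue`). The analytic
content is the existence and uniqueness of parallel lifts and their continuous dependence on `t`. In
a trivialization, a parallel lift over `f ∘ g`, with `f` a smooth extension of `σ`, solves the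
linear equation `w' = -H(g)(g') w` (`exists_local_ode`). Existence is Picard–Lindelöf on short
smooth pieces (`exists_linear_ode`). Uniqueness and continuity both come from `tendsto_linear_ode`.
The velocity of the path jumps at times that move with `t`, so the coefficients converge only
pointwise, off a finite set of times; but all paths are 2-Lipschitz, so the coefficients are bounded
and dominated convergence applies. `rel_of_forall_exists_local` passes from short intervals to the
whole one.

Commutation with `A₀` uses only the component of form degree 1 of `D² = 0`, which says `∇A₀ = 0`.
Hence `A₀` maps parallel lifts to parallel lifts (`IsParallelLift.differential`), and uniqueness of
lifts concludes. -/

/-- The sum `∑_{i ≥ m} x i` of the last coordinates of `x`. -/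
def tailSum {n : ℕ} (x : Fin n → ℝ) (m : ℕ) : ℝ := ∑ i : Fin n, if m ≤ (i : ℕ) then x i else 0

theorem tailSum_sub_tailSum_succ {n : ℕ} (x : Fin n → ℝ) (i : Fin n) :
    tailSum x i - tailSum x (i + 1) = x i := by
  rw [tailSum, tailSum, ← Finset.sum_sub_distrib, Finset.sum_eq_single i]
  · simp
  · intro j _ hj
    have : (j : ℕ) ≠ i := fun h => hj (Fin.ext h)
    split_ifs <;> first | omega | simp
  · simp

theorem eq_of_tailSum_eq {n : ℕ} {x y : Fin n → ℝ} (h : ∀ m, tailSum x m = tailSum y m) :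
    x = y := by
  funext i
  rw [← tailSum_sub_tailSum_succ x, ← tailSum_sub_tailSum_succ y, h, h]

theorem tailSum_telescope (y : ℕ → ℝ) (n m : ℕ) (h : m ≤ n) :
    tailSum (fun i : Fin n => y i - y (i + 1)) m = y m - y n := by
  induction n with
  | zero => obtain rfl : m = 0 := by omega
            simp [tailSum]
  | succ n ih =>
    rw [tailSum, Fin.sum_univ_castSucc]
    rcases h.lt_or_eq with h | rfl
    · have := ih (by omega)
      rw [tailSum] at this
      simp only [Fin.val_castSucc, Fin.val_last] at this ⊢
      rw [this, if_pos (by omega)]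
      ring
    · rw [if_neg (by simp), Finset.sum_eq_zero]
      · simp
      · intro i _
        rw [if_neg]
        simp only [Fin.val_castSucc]
        omega

theorem tailSum_eq_zero {n m : ℕ} (x : Fin n → ℝ) (h : n ≤ m) : tailSum x m = 0 :=
  Finset.sum_eq_zero fun i _ => if_neg (by omega)

/-- The preimage of the up-set `{i ≥ a}` under a monotone vertex map is an up-set `{i ≥ b}`. In tail
coordinates, face inclusions therefore only relabel coordinates, and the face relations reduce to
comparing partial sums. -/
theorem tailSum_map {k m : ℕ} (α : Fin (m + 1) →o Fin (k + 1))
    (x : stdSimplex ℝ (Fin (m + 1))) {a b : ℕ} (h : ∀ i, a ≤ (α i : ℕ) ↔ b ≤ (i : ℕ)) :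
    tailSum (stdSimplex.map α x : Fin (k + 1) → ℝ) a = tailSum (x : Fin (m + 1) → ℝ) b := by
  classical
  have : ∀ i, (stdSimplex.map α x : Fin (k + 1) → ℝ) i = ∑ j, if α j = i then x j else 0 := by
    intro i
    rw [stdSimplex.map_coe, FunOnFinite.linearMap_apply_apply, Finset.sum_filter]
  calc tailSum (stdSimplex.map α x : Fin (k + 1) → ℝ) a
      = ∑ i, ∑ j, if α j = i then (if a ≤ (i : ℕ) then x j else 0) else 0 := by
        refine Finset.sum_congr rfl fun i _ => ?_
        rw [this]
        split_ifs <;> simp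
    _ = tailSum (x : Fin (m + 1) → ℝ) b := by
        rw [Finset.sum_comm]
        refine Finset.sum_congr rfl fun j _ => ?_
        rw [Finset.sum_ite_eq Finset.univ (α j), if_pos (Finset.mem_univ _)]
        simp only [h]

/-! ### The paths -/

/-- The partial sum `∑_{i < j} t i`. -/
def partialSum {m : ℕ} (t : Fin m → unitInterval) (j : ℕ) : ℝ :=
  ∑ i : Fin m, if (i : ℕ) < j then (t i : ℝ) else 0

/-- The retraction of `ℝ` onto `[0, 1]`. -/
def clampUnit (r : ℝ) : ℝ := max 0 (min 1 r)

theorem clampUnit_of_le {r : ℝ} (h : r ≤ 0) : clampUnit r = 0 :=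
  max_eq_left ((min_le_right _ _).trans h)

theorem clampUnit_of_ge {r : ℝ} (h : 1 ≤ r) : clampUnit r = 1 := by
  simp [clampUnit, min_eq_left h]

theorem clampUnit_of_mem {r : ℝ} (h : r ∈ Icc (0 : ℝ) 1) : clampUnit r = r := by
  simp [clampUnit, min_eq_right h.2, h.1]

theorem clampUnit_nonneg (r : ℝ) : 0 ≤ clampUnit r := le_max_left _ _

theorem clampUnit_le_one (r : ℝ) : clampUnit r ≤ 1 := max_le zero_le_one (min_le_left _ _)

theorem clampUnit_mono : Monotone clampUnit := fun _ _ h =>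
  max_le_max le_rfl (min_le_min le_rfl h)

theorem continuous_clampUnit : Continuous clampUnit := by unfold clampUnit; fun_prop

theorem lipschitzWith_clampUnit : LipschitzWith 1 clampUnit :=
  (LipschitzWith.id.const_min 1).const_max 0

theorem partialSum_zero {m : ℕ} (t : Fin m → unitInterval) : partialSum t 0 = 0 := by
  simp [partialSum]

theorem partialSum_mono {m : ℕ} (t : Fin m → unitInterval) : Monotone (partialSum t) := by
  intro a b h
  refine Finset.sum_le_sum fun i _ => ?_
  have := (t i).2.1
  split_ifs <;> first | omega | positivity | exact le_rfl

theorem partialSum_nonneg {m : ℕ} (t : Fin m → unitInterval) (j : ℕ) : 0 ≤ partialSum t j :=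
  (partialSum_zero t).symm.trans_le (partialSum_mono t (Nat.zero_le _))

theorem partialSum_of_le {m : ℕ} (t : Fin m → unitInterval) {j : ℕ} (h : m ≤ j) :
    partialSum t j = ∑ i, (t i : ℝ) :=
  Finset.sum_congr rfl fun i _ => if_pos (by omega)

theorem partialSum_le_sum {m : ℕ} (t : Fin m → unitInterval) (j : ℕ) :
    partialSum t j ≤ ∑ i, (t i : ℝ) := by
  rw [← partialSum_of_le t (le_max_right j m)]
  exact partialSum_mono t (le_max_left _ _)

theorem continuous_partialSum {m : ℕ} (j : ℕ) :
    Continuous fun t : Fin m → unitInterval => partialSum t j := by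
  unfold partialSum
  refine continuous_finsetSum _ fun i _ => ?_
  split_ifs <;> fun_prop

/-- The tail coordinates of the point with parameter `s` of the path in `Δ^{m+1}` with
parameter `t`. -/
def cubeTail {m : ℕ} (t : Fin m → unitInterval) (s : ℝ) (j : ℕ) : ℝ :=
  match j with
  | 0 => 1
  -- This coordinate rises from 0 to 1 between the times `partialSum t j` and `partialSum t j + 1`.
  -- The value 0 beyond `m + 1` makes the telescoping sum of the barycentric coordinates equal to 1.
  | j + 1 => if j ≤ m then clampUnit (s - partialSum t j) else 0

theorem cubeTail_anti {m : ℕ} (t : Fin m → unitInterval) (s : ℝ) (j : ℕ) :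
    cubeTail t s (j + 1) ≤ cubeTail t s j := by
  cases j with
  | zero => simp only [cubeTail]; split_ifs <;> simp [clampUnit_le_one]
  | succ j =>
    simp only [cubeTail]
    split_ifs with h h'
    · exact clampUnit_mono (sub_le_sub_left (partialSum_mono t (Nat.le_succ j)) s)
    · omega
    · exact clampUnit_nonneg _
    · exact le_rfl

/-- The point with parameter `s` of the path in `Δ^{m+1}` with parameter `t`. -/
def cubePoint {m : ℕ} (t : Fin m → unitInterval) (s : ℝ) : stdSimplex ℝ (Fin (m + 1 + 1)) :=
  ⟨fun i => cubeTail t s i - cubeTail t s (i + 1),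
    fun i => sub_nonneg.2 (cubeTail_anti t s i), by
      have := tailSum_telescope (cubeTail t s) (m + 1 + 1) 0 (by omega)
      simpa [tailSum, cubeTail] using this⟩

theorem tailSum_cubePoint {m : ℕ} (t : Fin m → unitInterval) (s : ℝ) (j : ℕ) :
    tailSum (cubePoint t s : Fin (m + 1 + 1) → ℝ) j = cubeTail t s j := by
  rcases le_or_gt j (m + 1 + 1) with h | h
  · refine (tailSum_telescope (cubeTail t s) (m + 1 + 1) j h).trans ?_
    simp [cubeTail]
  · rw [tailSum_eq_zero _ h.le]
    obtain ⟨j, rfl⟩ := Nat.exists_eq_succ_of_ne_zero (by omega : j ≠ 0)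
    simp only [cubeTail]
    rw [if_neg (by omega)]

/-- Identities between points of simplices become scalar ones: the tail coordinate 0 is always 1 and
those beyond `m + 1` vanish, so only the clamped ones remain. -/
theorem eq_cubePoint {m : ℕ} {x : stdSimplex ℝ (Fin (m + 1 + 1))} {t : Fin m → unitInterval}
    {s : ℝ} (h : ∀ j, j ≤ m → tailSum (x : Fin (m + 1 + 1) → ℝ) (j + 1) =
      clampUnit (s - partialSum t j)) : x = cubePoint t s := by
  refine DFunLike.coe_injective (eq_of_tailSum_eq fun j => ?_)
  rw [tailSum_cubePoint]
  cases j with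
  | zero => simp [tailSum, cubeTail]
  | succ j =>
    simp only [cubeTail]
    split_ifs with hj
    · exact h j hj
    · exact tailSum_eq_zero _ (by omega)

theorem continuous_cubeTail {m : ℕ} (j : ℕ) :
    Continuous fun ts : (Fin m → unitInterval) × ℝ => cubeTail ts.1 ts.2 j := by
  cases j with
  | zero => exact continuous_const
  | succ j =>
    simp only [cubeTail]
    split_ifs
    · exact continuous_clampUnit.comp
        (continuous_snd.sub ((continuous_partialSum j).comp continuous_fst))
    · exact continuous_const

theorem continuous_cubePoint {m : ℕ} :
    Continuous fun ts : (Fin m → unitInterval) × ℝ => cubePoint ts.1 ts.2 :=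
  Continuous.subtype_mk (continuous_pi fun i : Fin (m + 1 + 1) =>
    Continuous.sub (continuous_cubeTail (i : ℕ)) (continuous_cubeTail ((i : ℕ) + 1))) _

theorem tailSum_vertex {n : ℕ} (i : Fin n) (j : ℕ) :
    tailSum (stdSimplex.vertex i : stdSimplex ℝ (Fin n)) j = if j ≤ (i : ℕ) then 1 else 0 := by
  rw [tailSum, Finset.sum_eq_single i]
  · simp
  · intro k _ hk
    simp [hk]
  · simp

theorem cubePoint_source {m : ℕ} (t : Fin m → unitInterval) {s : ℝ} (h : s ≤ 0) :
    cubePoint t s = stdSimplex.vertex 0 := by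
  symm
  refine eq_cubePoint fun j _ => ?_
  rw [tailSum_vertex, clampUnit_of_le (by linarith [partialSum_nonneg t j])]
  simp

theorem cubePoint_target {m : ℕ} (t : Fin m → unitInterval) {s : ℝ}
    (h : 1 + ∑ i, (t i : ℝ) ≤ s) : cubePoint t s = stdSimplex.vertex (Fin.last _) := by
  symm
  refine eq_cubePoint fun j hj => ?_
  rw [tailSum_vertex, clampUnit_of_ge (by linarith [partialSum_le_sum t j]), if_pos]
  simp only [Fin.val_last]
  omega

/-- With neither kink `o` nor `o + 1` inside the interval, the function is constantly 1, affine, or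
constantly 0 on all of it. -/
theorem clampUnit_sub_contDiffOn {a b o : ℝ} (h₀ : o ∉ Ioo a b) (h₁ : o + 1 ∉ Ioo a b) :
    ContDiffOn ℝ ∞ (fun s => clampUnit (s - o)) (Icc a b) := by
  simp only [mem_Ioo, not_and_or, not_lt] at h₀ h₁
  rcases h₀ with h₀ | h₀
  · rcases h₁ with h₁ | h₁
    · refine (contDiffOn_const (c := (1 : ℝ))).congr fun s hs => clampUnit_of_ge ?_
      linarith [hs.1]
    · refine ((contDiff_id.sub contDiff_const).contDiffOn).congr fun s hs =>
        clampUnit_of_mem (r := s - o) ⟨?_, ?_⟩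
      · linarith [hs.1]
      · linarith [hs.2]
  · refine (contDiffOn_const (c := (0 : ℝ))).congr fun s hs => clampUnit_of_le ?_
    linarith [hs.2]

/-- The parameters at which the path in `Δ^{m+1}` with parameter `t` may fail to be smooth. -/
def breakpoints {m : ℕ} (t : Fin m → unitInterval) : Set ℝ :=
  ⋃ j ∈ Iic m, {partialSum t j, partialSum t j + 1}

theorem finite_breakpoints {m : ℕ} (t : Fin m → unitInterval) : (breakpoints t).Finite :=
  (finite_Iic m).biUnion fun _ _ => toFinite _

theorem contDiffOn_cubeTail {m : ℕ} (t : Fin m → unitInterval) {a b : ℝ}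
    (h : Disjoint (Ioo a b) (breakpoints t)) (j : ℕ) :
    ContDiffOn ℝ ∞ (fun s => cubeTail t s j) (Icc a b) := by
  rcases j with _ | j
  · exact contDiffOn_const
  · simp only [cubeTail]
    split_ifs with hj
    · have hmem : ∀ x ∈ ({partialSum t j, partialSum t j + 1} : Set ℝ), x ∉ Ioo a b :=
        fun x hx hx' => disjoint_left.1 h hx' (mem_biUnion (mem_Iic.2 hj) hx)
      exact clampUnit_sub_contDiffOn (hmem _ (by simp)) (hmem _ (by simp))
    · exact contDiffOn_const

theorem contDiffOn_cubePoint {m : ℕ} (t : Fin m → unitInterval) {a b : ℝ}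
    (h : Disjoint (Ioo a b) (breakpoints t)) :
    ContDiffOn ℝ ∞ (fun s => (cubePoint t s : Fin (m + 1 + 1) → ℝ)) (Icc a b) :=
  contDiffOn_pi.2 fun _ => (contDiffOn_cubeTail t h _).sub (contDiffOn_cubeTail t h _)

/-- The path in `Δ^{m+1}` with parameter `t`. -/
def cubePath {m : ℕ} (t : Fin m → unitInterval) : SimplexPath (m + 1) where
  length := 1 + ∑ i, (t i : ℝ)
  length_nonneg := add_nonneg zero_le_one (Finset.sum_nonneg fun i _ => (t i).2.1)
  toFun := cubePoint t
  eq_source _ hs := (cubePoint_source t hs).trans (cubePoint_source t le_rfl).symm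
  eq_target _ hs := (cubePoint_target t hs).trans (cubePoint_target t le_rfl).symm
  continuous := continuous_cubePoint.comp (Continuous.prodMk_right t)
  piecewise_smooth := ⟨breakpoints t, finite_breakpoints t, fun _ _ _ h =>
    contDiffOn_cubePoint t h⟩

/-- The trivial path in `Δ^0`. -/
def trivialPath : SimplexPath 0 where
  length := 0
  length_nonneg := le_rfl
  toFun _ := stdSimplex.vertex 0
  eq_source _ _ := rfl
  eq_target _ _ := rfl
  continuous := continuous_const
  piecewise_smooth := ⟨∅, finite_empty, fun _ _ _ _ => contDiffOn_const⟩

/-! ### Face relations of the paths -/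

theorem partialSum_removeNth {n : ℕ} (p : Fin (n + 1)) (t : Fin (n + 1) → unitInterval)
    (h : t p = 0) (j : ℕ) :
    partialSum (p.removeNth t) j = partialSum t (if j ≤ p then j else j + 1) := by
  rw [partialSum, partialSum, Fin.sum_univ_succAbove _ p, h]
  simp only [Icc.coe_zero, ite_self, zero_add, Fin.removeNth]
  refine Finset.sum_congr rfl fun i _ => if_congr ?_ rfl rfl
  simp only [Fin.succAbove, Fin.lt_def, Fin.val_castSucc]
  split_ifs <;> simp <;> omega

/-- The inserted entry 1 delays every ramp behind the joint by one unit, hence until the front path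
is complete. The truncated subtraction makes the last term vanish for `j ≤ a + 1`. -/
theorem partialSum_append_snoc {a b : ℕ} (t : Fin a → unitInterval) (t' : Fin b → unitInterval)
    (j : ℕ) : partialSum (Fin.append (Fin.snoc t 1 : Fin (a + 1) → unitInterval) t') j =
      partialSum t j + (if a < j then 1 else 0) + partialSum t' (j - (a + 1)) := by
  simp only [partialSum, Fin.sum_univ_add, Fin.sum_univ_castSucc, Fin.append_left,
    Fin.append_right, Fin.snoc_castSucc, Fin.snoc_last, Fin.val_castAdd, Fin.val_castSucc,
    Fin.val_last, Fin.val_natAdd, Icc.coe_one]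
  refine congrArg _ (Finset.sum_congr rfl fun i _ => if_congr ?_ rfl rfl)
  omega

/-- The path of the family with parameter `t`. -/
def pathOfCube (k : ℕ) (t : Fin (k - 1) → unitInterval) : SimplexPath k :=
  match k, t with
  | 0, _ => trivialPath
  | _ + 1, t => cubePath t

/-- A compatible family of paths in simplices. -/
def simplexPathFamily : SimplexPathFamily where
  path := pathOfCube
  continuous_length k := by
    cases k with
    | zero => exact continuous_const
    | succ k => exact continuous_const.add (continuous_finsetSum _ fun i _ =>
        continuous_subtype_val.comp (continuous_apply i))
  continuous_path k := by
    cases k with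
    | zero => exact continuous_const
    | succ k => exact continuous_cubePoint
  source k t := by
    cases k with
    | zero => rfl
    | succ k => exact cubePoint_source t le_rfl
  target k t := by
    cases k with
    | zero => rfl
    | succ k => exact cubePoint_target t le_rfl
  point t := rfl
  edge t := by
    refine ⟨by simp [pathOfCube, cubePath], fun s hs => ?_⟩
    change cubeTail t s 1 - cubeTail t s 2 = s
    simp [cubeTail, partialSum_zero, clampUnit_of_mem hs]
  face_zero n p t h := by
    constructor
    · change 1 + ∑ i, (t i : ℝ) = 1 + ∑ i, (p.removeNth t i : ℝ)
      rw [Fin.sum_univ_succAbove _ p, h]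
      simp [Fin.removeNth]
    · intro s
      symm
      refine eq_cubePoint fun j hj => ?_
      -- `b` is the index on the smaller simplex that corresponds to `j`: it is `j` in front of the
      -- omitted vertex `p + 1`, and `j - 1` behind it.
      have key : ∀ b, (∀ i : Fin (n + 2), j + 1 ≤ (faceMap p.succ.castSucc i : ℕ) ↔
          b + 1 ≤ (i : ℕ)) → b ≤ n → partialSum (p.removeNth t) b = partialSum t j →
          tailSum (stdSimplex.map (faceMap p.succ.castSucc) (cubePoint (p.removeNth t) s) :
            Fin (n + 2 + 1) → ℝ) (j + 1) = clampUnit (s - partialSum t j) := by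
        intro b hb hbn hbt
        rw [tailSum_map _ _ hb, tailSum_cubePoint, cubeTail, if_pos hbn, hbt]
      have hp := p.2
      rcases le_or_gt j p with hjp | hjp
      · refine key j (fun i => ?_) (by omega) (by rw [partialSum_removeNth p t h, if_pos hjp])
        simp only [faceMap, OrderEmbedding.toOrderHom_coe, Fin.succAboveOrderEmb_apply,
          Fin.succAbove, Fin.lt_def, Fin.val_castSucc, Fin.val_succ]
        split_ifs <;> simp <;> omega
      · refine key (j - 1) (fun i => ?_) (by omega) ?_
        · simp only [faceMap, OrderEmbedding.toOrderHom_coe, Fin.succAboveOrderEmb_apply,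
            Fin.succAbove, Fin.lt_def, Fin.val_castSucc, Fin.val_succ]
          split_ifs <;> simp <;> omega
        · rw [partialSum_removeNth p t h]
          split_ifs with hj'
          -- Just behind the omitted vertex the two sums differ by `t p`, which is 0.
          · obtain rfl : j = p + 1 := by omega
            simp only [partialSum, Nat.add_sub_cancel]
            refine Finset.sum_congr rfl fun i _ => ?_
            rcases eq_or_ne i p with rfl | hi
            · simp [h]
            · have : (i : ℕ) ≠ p := fun h => hi (Fin.ext h)
              exact if_congr (by omega) rfl rfl
          · rw [Nat.sub_add_cancel (by omega)]
  face_one a b t t' := by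
    have hlen : ∀ j, partialSum t j ≤ ∑ i, (t i : ℝ) := partialSum_le_sum t
    refine ⟨?_, fun s hs => ?_, fun s hs => ?_⟩
    · change 1 + ∑ i, ((Fin.append (Fin.snoc t 1 : Fin (a + 1) → unitInterval) t' i : unitInterval) : ℝ) =
        (1 + ∑ i, (t i : ℝ)) + (1 + ∑ i, (t' i : ℝ))
      simp only [Fin.sum_univ_add, Fin.sum_univ_castSucc, Fin.append_left, Fin.append_right,
        Fin.snoc_castSucc, Fin.snoc_last, Icc.coe_one]
      ring
    · change s ≤ 1 + ∑ i, (t i : ℝ) at hs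
      symm
      refine eq_cubePoint fun j hj => ?_
      refine (tailSum_map (b := j + 1) _ _ fun i => Iff.rfl).trans ?_
      refine (tailSum_cubePoint t s (j + 1)).trans ?_
      rw [partialSum_append_snoc, cubeTail]
      rcases le_or_gt j a with hja | hja
      · rw [if_pos hja, if_neg (by omega), Nat.sub_eq_zero_of_le (by omega), partialSum_zero]
        simp
      -- The coordinates of the back block have not started to rise while `s` is at most the length
      -- of the front path.
      · rw [if_neg (by omega), if_pos hja, clampUnit_of_le]
        have := partialSum_nonneg t' (j - (a + 1))
        rw [partialSum_of_le t hja.le]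
        linarith
    · change s ≥ 1 + ∑ i, (t i : ℝ) at hs
      symm
      refine eq_cubePoint fun j hj => ?_
      replace hj : j ≤ a + 1 + b := hj
      refine (tailSum_map (b := j - a) _ _ fun i => ?_).trans ?_
      · simp only [backMap, OrderEmbedding.toOrderHom_coe, Fin.natAddOrderEmb_apply,
          Fin.val_natAdd]
        omega
      refine (tailSum_cubePoint t' (s - (1 + ∑ i, (t i : ℝ))) (j - a)).trans ?_
      rw [partialSum_append_snoc]
      rcases le_or_gt j a with hja | hja
      -- The coordinates of the front block have already reached 1; on the back path they correspond
      -- to the tail coordinate `j - a = 0`.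
      · rw [if_neg (by omega), Nat.sub_eq_zero_of_le (by omega : j ≤ a + 1), partialSum_zero,
          Nat.sub_eq_zero_of_le hja, cubeTail, clampUnit_of_ge]
        linarith [hlen j]
      · obtain ⟨j, rfl⟩ : ∃ j', j = a + 1 + j' := ⟨j - (a + 1), by omega⟩
        rw [if_pos (by omega), show a + 1 + j - a = j + 1 by omega, Nat.add_sub_cancel_left,
          partialSum_of_le t (by omega), cubeTail, if_pos (by omega)]
        congr 1
        ring

/-! ### Regularity of the paths in dependence of the parameter -/

/-- Barycentric coordinates are differences of two 1-Lipschitz tail coordinates. The constant does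
not depend on `t`, which gives the uniform bound on velocities needed for dominated convergence. -/
theorem lipschitzWith_cubePoint {m : ℕ} (t : Fin m → unitInterval) :
    LipschitzWith 2 fun s => (cubePoint t s : Fin (m + 1 + 1) → ℝ) := by
  have h : ∀ j, LipschitzWith 1 fun s => cubeTail t s j := by
    intro j
    rcases j with _ | j
    · exact LipschitzWith.const' _
    · simp only [cubeTail]
      split_ifs
      · have := lipschitzWith_clampUnit.comp
          ((LipschitzWith.id (α := ℝ)).sub (LipschitzWith.const (partialSum t j)))
        rwa [add_zero, one_mul] at this
      · exact LipschitzWith.const' _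
  rw [← one_add_one_eq_two]
  exact LipschitzWith.of_dist_le_mul fun s s' => (dist_pi_le_iff (by positivity)).2 fun i =>
    ((h i).sub (h (i + 1))).dist_le_mul s s'

theorem hasDerivAt_clampUnit {r : ℝ} (h₀ : r ≠ 0) (h₁ : r ≠ 1) :
    HasDerivAt clampUnit (indicator (Icc 0 1) (1 : ℝ → ℝ) r) r := by
  rcases h₀.lt_or_gt with h₀ | h₀
  · rw [indicator_of_notMem (fun h : r ∈ Icc (0 : ℝ) 1 => h.1.not_gt h₀)]
    exact (hasDerivAt_const r (0 : ℝ)).congr_of_eventuallyEq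
      (by filter_upwards [gt_mem_nhds h₀] with x hx using clampUnit_of_le hx.le)
  · rcases h₁.lt_or_gt with h₁ | h₁
    · rw [indicator_of_mem (mem_Icc.2 ⟨h₀.le, h₁.le⟩)]
      exact (hasDerivAt_id r).congr_of_eventuallyEq
        (by filter_upwards [Ioo_mem_nhds h₀ h₁] with x hx using
          clampUnit_of_mem (Ioo_subset_Icc_self hx))
    · rw [indicator_of_notMem (fun h : r ∈ Icc (0 : ℝ) 1 => h.2.not_gt h₁)]
      exact (hasDerivAt_const r (1 : ℝ)).congr_of_eventuallyEq
        (by filter_upwards [lt_mem_nhds h₁] with x hx using clampUnit_of_ge hx.le)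

theorem continuousAt_indicator_Icc {r : ℝ} (h₀ : r ≠ 0) (h₁ : r ≠ 1) :
    ContinuousAt (indicator (Icc 0 1) (1 : ℝ → ℝ)) r := by
  refine ContinuousOn.continuousAt_indicator continuousOn_const ?_
  rw [frontier_Icc zero_le_one]
  simp [h₀, h₁]

/-- The derivative of `cubeTail` in the time variable. -/
def cubeTailDeriv {m : ℕ} (t : Fin m → unitInterval) (s : ℝ) (j : ℕ) : ℝ :=
  match j with
  | 0 => 0
  | j + 1 => if j ≤ m then indicator (Icc 0 1) (1 : ℝ → ℝ) (s - partialSum t j) else 0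

theorem sub_partialSum_ne {m : ℕ} {t : Fin m → unitInterval} {s : ℝ} (h : s ∉ breakpoints t)
    {j : ℕ} (hj : j ≤ m) : s - partialSum t j ≠ 0 ∧ s - partialSum t j ≠ 1 := by
  constructor
  · exact fun h' => h (mem_biUnion (mem_Iic.2 hj) (Or.inl (sub_eq_zero.1 h')))
  · exact fun h' => h (mem_biUnion (mem_Iic.2 hj) (Or.inr (by
      rw [mem_singleton_iff]; linarith)))

theorem hasDerivAt_cubeTail {m : ℕ} {t : Fin m → unitInterval} {s : ℝ} (h : s ∉ breakpoints t)
    (j : ℕ) : HasDerivAt (fun s => cubeTail t s j) (cubeTailDeriv t s j) s := by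
  rcases j with _ | j
  · exact hasDerivAt_const _ _
  · simp only [cubeTail, cubeTailDeriv]
    split_ifs with hj
    · obtain ⟨h₀, h₁⟩ := sub_partialSum_ne h hj
      exact (hasDerivAt_clampUnit h₀ h₁).comp_sub_const s _
    · exact hasDerivAt_const _ _

theorem hasDerivAt_cubePoint {m : ℕ} {t : Fin m → unitInterval} {s : ℝ}
    (h : s ∉ breakpoints t) :
    HasDerivAt (fun s => (cubePoint t s : Fin (m + 1 + 1) → ℝ))
      (fun i => cubeTailDeriv t s i - cubeTailDeriv t s (i + 1)) s :=
  hasDerivAt_pi.2 fun _ => (hasDerivAt_cubeTail h _).sub (hasDerivAt_cubeTail h _)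

theorem continuousAt_cubeTailDeriv {m : ℕ} {t : Fin m → unitInterval} {s : ℝ}
    (h : s ∉ breakpoints t) (j : ℕ) : ContinuousAt (fun t => cubeTailDeriv t s j) t := by
  rcases j with _ | j
  · exact continuousAt_const
  · simp only [cubeTailDeriv]
    split_ifs with hj
    · obtain ⟨h₀, h₁⟩ := sub_partialSum_ne h hj
      exact ContinuousAt.comp (f := fun t => s - partialSum t j) (continuousAt_indicator_Icc h₀ h₁)
        (continuous_const.sub (continuous_partialSum j)).continuousAt
    · exact continuousAt_const

theorem eventually_notMem_breakpoints {m : ℕ} {t : Fin m → unitInterval} {s : ℝ}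
    (h : s ∉ breakpoints t) : ∀ᶠ t' in 𝓝 t, s ∉ breakpoints t' := by
  have : ∀ j ∈ Iic m, ∀ᶠ t' in 𝓝 t, s ∉ ({partialSum t' j, partialSum t' j + 1} : Set ℝ) := by
    intro j hj
    have h₀ : s ≠ partialSum t j := fun h' => h (mem_biUnion hj (Or.inl h'))
    have h₁ : s ≠ partialSum t j + 1 := fun h' => h (mem_biUnion hj (Or.inr h'))
    have hc : ContinuousAt (fun t' : Fin m → unitInterval => partialSum t' j) t :=
      (continuous_partialSum j).continuousAt
    filter_upwards [hc.eventually_ne h₀.symm, hc.eventually_ne (y := s - 1) (fun h' => h₁ (by rw [h', sub_add_cancel]))]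
      with t' ht₀ ht₁
    simp only [mem_insert_iff, mem_singleton_iff, not_or]
    exact ⟨ht₀.symm, fun h' => ht₁ (by rw [h', add_sub_cancel_right])⟩
  filter_upwards [(Filter.eventually_all_finite (finite_Iic m)).2 this] with t' ht'
  simpa only [breakpoints, mem_iUnion, not_exists] using ht'

theorem lipschitzWith_pathOfCube (k : ℕ) (t : Fin (k - 1) → unitInterval) :
    LipschitzWith 2 fun s => ((pathOfCube k t).toFun s : Fin (k + 1) → ℝ) := by
  cases k with
  | zero => exact LipschitzWith.const' _
  | succ k => exact lipschitzWith_cubePoint t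

/-- The exceptional times are the breakpoints of the limit path. Breakpoints move with the
parameter, so uniform convergence of the velocities cannot be expected at the jumps; pointwise
convergence off a finite set is enough here. -/
theorem tendsto_deriv_pathOfCube (k : ℕ) (t : Fin (k - 1) → unitInterval) :
    ∃ S : Set ℝ, S.Finite ∧ ∀ s ∉ S, Filter.Tendsto
      (fun t => deriv (fun s => ((pathOfCube k t).toFun s : Fin (k + 1) → ℝ)) s) (𝓝 t)
      (𝓝 (deriv (fun s => ((pathOfCube k t).toFun s : Fin (k + 1) → ℝ)) s)) := by
  cases k with
  | zero => exact ⟨∅, finite_empty, fun s _ => tendsto_const_nhds⟩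
  | succ k =>
    refine ⟨breakpoints t, finite_breakpoints t, fun s hs => ?_⟩
    change ContinuousAt (fun t => deriv (fun s => (cubePoint t s : Fin (k + 1 + 1) → ℝ)) s) t
    refine ContinuousAt.congr (f := fun t => fun i : Fin (k + 1 + 1) =>
      cubeTailDeriv t s i - cubeTailDeriv t s (i + 1)) ?_ ?_
    · exact continuousAt_pi.2 fun i =>
        (continuousAt_cubeTailDeriv hs _).sub (continuousAt_cubeTailDeriv hs _)
    · filter_upwards [eventually_notMem_breakpoints hs] with t' ht'
      exact (hasDerivAt_cubePoint ht').deriv.symm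

/-- The lengths vary with `t`; a common bound allows all lifts to be compared on one interval `[0,
L]`. -/
theorem exists_length_le_pathOfCube (k : ℕ) :
    ∃ L : ℝ, ∀ t, (pathOfCube k t).length ≤ L := by
  cases k with
  | zero => exact ⟨0, fun _ => le_rfl⟩
  | succ k =>
    refine ⟨1 + ∑ _i : Fin k, 1, fun t => ?_⟩
    exact add_le_add le_rfl (Finset.sum_le_sum fun i _ => (t i).2.2)

/-! ### The connection form in a local trivialization -/

theorem mvfderiv_clm_apply {d : ℕ} {M : Type*} [TopologicalSpace M]
    [ChartedSpace (EuclideanSpace ℝ (Fin d)) M] {F F' : Type*} [NormedAddCommGroup F]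
    [NormedSpace ℝ F] [NormedAddCommGroup F'] [NormedSpace ℝ F'] {w : M → F}
    {x : M} (hw : MDifferentiableAt (𝓡 d) 𝓘(ℝ, F) w x) (L : F →L[ℝ] F')
    (X : TangentSpace (𝓡 d) x) :
    mvfderiv (𝓡 d) (fun y => L (w y)) x X = L (mvfderiv (𝓡 d) w x X) := by
  have h : HasMFDerivAt 𝓘(ℝ, F) 𝓘(ℝ, F') L (w x) L := L.hasMFDerivAt
  have := (h.comp x hw.hasMFDerivAt).mfderiv
  change mfderiv (𝓡 d) 𝓘(ℝ, F') (L ∘ w) x X = _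
  rw [this]
  rfl

theorem MDifferentiableAt.hasDerivAt_comp_curve {d : ℕ} {M : Type*} [TopologicalSpace M]
    [ChartedSpace (EuclideanSpace ℝ (Fin d)) M] {F : Type*} [NormedAddCommGroup F]
    [NormedSpace ℝ F] {w : M → F} {c : ℝ → M} {s : ℝ}
    (hw : MDifferentiableAt (𝓡 d) 𝓘(ℝ, F) w (c s))
    (hc : MDifferentiableAt 𝓘(ℝ, ℝ) (𝓡 d) c s) :
    HasDerivAt (fun r => w (c r))
      (mvfderiv (𝓡 d) w (c s) (mfderiv 𝓘(ℝ, ℝ) (𝓡 d) c s (1 : ℝ))) s := by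
  let L : ℝ →L[ℝ] F := (mvfderiv (𝓡 d) w (c s)).comp (mfderiv 𝓘(ℝ, ℝ) (𝓡 d) c s)
  have h : HasFDerivAt (fun r => w (c r)) L s :=
    hasMFDerivAt_iff_hasFDerivAt.1 (hw.hasMFDerivAt.comp s hc.hasMFDerivAt)
  exact h.hasDerivAt

section Connection

variable {d : ℕ} {M : Type*} [TopologicalSpace M] [ChartedSpace (EuclideanSpace ℝ (Fin d)) M]
  [IsManifold (𝓡 d) ∞ M]
  {F : Type*} [NormedAddCommGroup F] [NormedSpace ℝ F] [FiniteDimensional ℝ F]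
  {E : M → Type*} [TopologicalSpace (TotalSpace F E)]
  [∀ x, AddCommGroup (E x)] [∀ x, Module ℝ (E x)] [∀ x, TopologicalSpace (E x)]
  [∀ x, IsTopologicalAddGroup (E x)] [∀ x, ContinuousSMul ℝ (E x)]
  [FiberBundle F E] [VectorBundle ℝ F E]

theorem connectionForm_apply (cov : CovariantDerivative (𝓡 d) F E) (x₀ x : M)
    (X : TangentSpace (𝓡 d) x) (v : F) :
    connectionForm cov x₀ x X v = ∑ a, (Module.finBasis ℝ F).repr v a •
      (trivializationAt F E x₀).continuousLinearMapAt ℝ x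
        (cov (fun y => (trivializationAt F E x₀).symm y (Module.finBasis ℝ F a)) x X) := by
  simp only [connectionForm, sum_apply]
  rfl

variable [ContMDiffVectorBundle ∞ F E (𝓡 d)]

theorem contMDiffOn_trivialization_symm (x₀ : M) (v : F) :
    ContMDiffOn (𝓡 d) ((𝓡 d).prod 𝓘(ℝ, F)) ∞
      (fun y => (⟨y, (trivializationAt F E x₀).symm y v⟩ : TotalSpace F E))
      (trivializationAt F E x₀).baseSet := by
  refine ((trivializationAt F E x₀).contMDiffOn_section_baseSet_iff).2 ?_
  refine (contMDiffOn_const (c := v)).congr fun y hy => ?_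
  rw [Trivialization.apply_mk_symm _ hy]

theorem CovariantDerivative.map_sum (cov : CovariantDerivative (𝓡 d) F E) {ι : Type*}
    (t : Finset ι) (s : ι → ∀ y, E y) {x : M}
    (hs : ∀ i, MDifferentiableAt (𝓡 d) ((𝓡 d).prod 𝓘(ℝ, F))
      (fun y => (⟨y, s i y⟩ : TotalSpace F E)) x) :
    cov (fun y => ∑ i ∈ t, s i y) x = ∑ i ∈ t, cov (s i) x := by
  classical
  have : ContMDiffVectorBundle 1 F E (𝓡 d) := ContMDiffVectorBundle.of_le (n := ∞) (by simp)
  induction t using Finset.induction_on with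
  | empty =>
    simp only [Finset.sum_empty]
    exact cov.isCovariantDerivativeOnUniv.zero
  | insert i t hi ih =>
    simp only [Finset.sum_insert hi]
    rw [← ih]
    exact cov.isCovariantDerivativeOnUniv.add (hs i) (MDifferentiableAt.sum_section fun j _ => hs j)

theorem mdifferentiableAt_trivialization_symm {x₀ x : M}
    (hx : x ∈ (trivializationAt F E x₀).baseSet) {w : M → F}
    (hw : MDifferentiableAt (𝓡 d) 𝓘(ℝ, F) w x) :
    MDifferentiableAt (𝓡 d) ((𝓡 d).prod 𝓘(ℝ, F))
      (fun y => (⟨y, (trivializationAt F E x₀).symm y (w y)⟩ : TotalSpace F E)) x := by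
  have : ContMDiffVectorBundle 1 F E (𝓡 d) := ContMDiffVectorBundle.of_le (n := ∞) (by simp)
  refine ((trivializationAt F E x₀).mdifferentiableAt_section_iff _ _ hx).2 ?_
  refine hw.congr_of_eventuallyEq ?_
  filter_upwards [(trivializationAt F E x₀).open_baseSet.mem_nhds hx] with y hy
  rw [Trivialization.apply_mk_symm _ hy]

theorem trivialization_symm_eq_sum {x₀ x : M}
    (hx : x ∈ (trivializationAt F E x₀).baseSet) (v : F) :
    (trivializationAt F E x₀).symm x v = ∑ a, (Module.finBasis ℝ F).repr v a •
      (trivializationAt F E x₀).symm x (Module.finBasis ℝ F a) := by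
  simp only [← Trivialization.symmL_apply (R := ℝ) _ hx]
  conv_lhs => rw [← (Module.finBasis ℝ F).sum_repr v]
  simp only [map_sum, map_smul]

/-- The covariant derivative of a section in a local trivialization. -/
theorem CovariantDerivative.trivialization_apply (cov : CovariantDerivative (𝓡 d) F E)
    {x₀ x : M} (hx : x ∈ (trivializationAt F E x₀).baseSet) {s : ∀ y, E y} {w : M → F}
    (hw : MDifferentiableAt (𝓡 d) 𝓘(ℝ, F) w x)
    (hs : ∀ᶠ y in 𝓝 x, s y = (trivializationAt F E x₀).symm y (w y))
    (X : TangentSpace (𝓡 d) x) :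
    (trivializationAt F E x₀).continuousLinearMapAt ℝ x (cov s x X) =
      mvfderiv (𝓡 d) w x X + connectionForm cov x₀ x X (w x) := by
  set e := trivializationAt F E x₀ with he
  set b := Module.finBasis ℝ F with hb
  have : ContMDiffVectorBundle 1 F E (𝓡 d) := ContMDiffVectorBundle.of_le (n := ∞) (by simp)
  let L : Fin (Module.finrank ℝ F) → F →L[ℝ] ℝ := fun a =>
    LinearMap.toContinuousLinearMap (b.coord a)
  have hL : ∀ a v, L a v = b.repr v a := fun a v => rfl
  have hwa : ∀ a, MDifferentiableAt (𝓡 d) 𝓘(ℝ, ℝ) (fun y => L a (w y)) x := fun a =>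
    (L a).mdifferentiableAt.comp x hw
  have hsa : ∀ a, MDifferentiableAt (𝓡 d) ((𝓡 d).prod 𝓘(ℝ, F))
      (fun y => (⟨y, e.symm y (b a)⟩ : TotalSpace F E)) x := fun a =>
    mdifferentiableAt_trivialization_symm hx mdifferentiableAt_const
  have hprod : ∀ a, MDifferentiableAt (𝓡 d) ((𝓡 d).prod 𝓘(ℝ, F))
      (fun y => (⟨y, ((fun y => L a (w y)) • fun y => e.symm y (b a)) y⟩ : TotalSpace F E)) x :=
    fun a => (hwa a).smul_section (hsa a)
  -- Near `x` the section is expanded in the local frame. In the Leibniz rule the derivatives of the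
  -- coefficients add up to `dw`, and those of the frame to the connection form.
  have h₁ : cov s x = cov (fun y => ∑ a,
      ((fun y => L a (w y)) • fun y => e.symm y (b a)) y) x := by
    refine cov.isCovariantDerivativeOnUniv.congr_of_eventuallyEq ?_
      (MDifferentiableAt.sum_section fun a _ => hprod a) Filter.univ_mem ?_
    · refine (mdifferentiableAt_trivialization_symm hx hw).congr_of_eventuallyEq ?_
      filter_upwards [hs] with y hy
      rw [hy]
    · filter_upwards [hs, e.open_baseSet.mem_nhds hx] with y hy hye
      rw [hy, trivialization_symm_eq_sum hye]
      rfl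
  rw [h₁, cov.map_sum _ _ hprod]
  simp only [cov.isCovariantDerivativeOnUniv.leibniz (hsa _) (hwa _)]
  rw [connectionForm_apply]
  change e.continuousLinearMapAt ℝ x _ = _ + ∑ a, b.repr (w x) a •
    e.continuousLinearMapAt ℝ x (cov (fun y => e.symm y (b a)) x X)
  rw [sum_apply, _root_.map_sum]
  simp only [add_apply, map_add, Finset.sum_add_distrib, smul_apply, map_smul]
  rw [add_comm]
  congr 1
  conv_rhs => rw [← b.sum_repr (mvfderiv (𝓡 d) w x X)]
  refine Finset.sum_congr rfl fun a _ => ?_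
  rw [ContinuousLinearMap.smulRight_apply, map_smul, mvfderiv_clm_apply hw, hL,
    ← Trivialization.symmL_apply (R := ℝ) _ hx,
    Trivialization.continuousLinearMapAt_symmL _ hx]

/-- The transformation rule for the connection form. -/
theorem connectionForm_transform (cov : CovariantDerivative (𝓡 d) F E) {x₀ x₁ x : M}
    (h₀ : x ∈ (trivializationAt F E x₀).baseSet) (h₁ : x ∈ (trivializationAt F E x₁).baseSet)
    (X : TangentSpace (𝓡 d) x) (v : F) :
    (trivializationAt F E x₁).coordChangeL ℝ (trivializationAt F E x₀) x
        (connectionForm cov x₁ x X v) =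
      mvfderiv (𝓡 d) (fun y => ((trivializationAt F E x₁).coordChangeL ℝ
        (trivializationAt F E x₀) y : F →L[ℝ] F) v) x X + connectionForm cov x₀ x X
      ((trivializationAt F E x₁).coordChangeL ℝ (trivializationAt F E x₀) x v) := by
  have : ContMDiffVectorBundle 1 F E (𝓡 d) := ContMDiffVectorBundle.of_le (n := ∞) (by simp)
  have hg : MDifferentiableAt (𝓡 d) 𝓘(ℝ, F) (fun y => ((trivializationAt F E x₁).coordChangeL ℝ
        (trivializationAt F E x₀) y : F →L[ℝ] F) v) x :=
    (mdifferentiableAt_coordChangeL h₁ h₀).clm_apply mdifferentiableAt_const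
  -- The section that is constant `v` in the trivialization at `x₁` is differentiated in both
  -- trivializations, and the results are compared.
  have e₁ := cov.trivialization_apply h₁ (s := fun y => (trivializationAt F E x₁).symm y v)
    (w := fun _ => v) mdifferentiableAt_const (Filter.Eventually.of_forall fun _ => rfl) X
  have e₀ := cov.trivialization_apply h₀ (s := fun y => (trivializationAt F E x₁).symm y v)
    hg (by
      filter_upwards [(trivializationAt F E x₀).open_baseSet.mem_nhds h₀,
        (trivializationAt F E x₁).open_baseSet.mem_nhds h₁] with y hy₀ hy₁
      rw [ContinuousLinearEquiv.coe_coe, Trivialization.coordChangeL_apply _ _ ⟨hy₁, hy₀⟩,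
        Trivialization.symm_apply_apply_mk _ hy₀]) X
  refine Eq.trans ?_ e₀
  rw [mvfderiv_const, zero_apply, zero_add] at e₁
  rw [← e₁, Trivialization.coordChangeL_apply _ _ ⟨h₁, h₀⟩,
    Trivialization.continuousLinearMapAt_apply_of_mem ℝ _ h₁,
    Trivialization.symm_apply_apply_mk _ h₁,
    Trivialization.continuousLinearMapAt_apply_of_mem ℝ _ h₀]

theorem trivialization_apply_eq_coordChangeL {x₀ x₁ : M} (z : TotalSpace F E)
    (h₀ : z.proj ∈ (trivializationAt F E x₀).baseSet)
    (h₁ : z.proj ∈ (trivializationAt F E x₁).baseSet) :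
    (trivializationAt F E x₀ z).2 = (trivializationAt F E x₁).coordChangeL ℝ
      (trivializationAt F E x₀) z.proj (trivializationAt F E x₁ z).2 := by
  rw [Trivialization.coordChangeL_apply _ _ ⟨h₁, h₀⟩]
  congr 2
  obtain ⟨x, v⟩ := z
  rw [Trivialization.symm_apply_apply_mk _ h₁]

/-- The equation of parallel lifts does not depend on the trivialization. -/
theorem hasDerivAt_parallel_change (cov : CovariantDerivative (𝓡 d) F E) {x₀ x₁ : M}
    {c : ℝ → M} {u : ℝ → TotalSpace F E} {s : ℝ} (hu : ∀ r, (u r).proj = c r)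
    (hc : MDifferentiableAt 𝓘(ℝ, ℝ) (𝓡 d) c s)
    (h₀ : c s ∈ (trivializationAt F E x₀).baseSet) (h₁ : c s ∈ (trivializationAt F E x₁).baseSet)
    (h : HasDerivAt (fun r => (trivializationAt F E x₁ (u r)).2)
      (-(connectionForm cov x₁ (c s) (mfderiv 𝓘(ℝ, ℝ) (𝓡 d) c s (1 : ℝ))
        (trivializationAt F E x₁ (u s)).2)) s) :
    HasDerivAt (fun r => (trivializationAt F E x₀ (u r)).2)
      (-(connectionForm cov x₀ (c s) (mfderiv 𝓘(ℝ, ℝ) (𝓡 d) c s (1 : ℝ))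
        (trivializationAt F E x₀ (u s)).2)) s := by
  have : ContMDiffVectorBundle 1 F E (𝓡 d) := ContMDiffVectorBundle.of_le (n := ∞) (by simp)
  set X := mfderiv 𝓘(ℝ, ℝ) (𝓡 d) c s (1 : ℝ) with hX
  set w : F := (trivializationAt F E x₁ (u s)).2 with hw
  let g : M → F →L[ℝ] F := fun y =>
    ((trivializationAt F E x₁).coordChangeL ℝ (trivializationAt F E x₀) y : F →L[ℝ] F)
  have hg : MDifferentiableAt (𝓡 d) 𝓘(ℝ, F →L[ℝ] F) g (c s) := mdifferentiableAt_coordChangeL h₁ h₀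
  have hev : ∀ᶠ r in 𝓝 s, (trivializationAt F E x₀ (u r)).2 =
      g (c r) (trivializationAt F E x₁ (u r)).2 := by
    have hcs := hc.continuousAt
    filter_upwards [hcs.eventually_mem ((trivializationAt F E x₀).open_baseSet.mem_nhds h₀),
      hcs.eventually_mem ((trivializationAt F E x₁).open_baseSet.mem_nhds h₁)] with r hr₀ hr₁
    rw [← hu r] at hr₀ hr₁ ⊢
    exact trivialization_apply_eq_coordChangeL _ hr₀ hr₁
  have hder := ((hg.hasDerivAt_comp_curve hc).clm_apply h).congr_of_eventuallyEq hev
  convert! hder using 1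
  -- The derivative of the transition function produced by the product rule cancels the
  -- inhomogeneous term of the transformation rule.
  have htr := connectionForm_transform cov h₀ h₁ X w
  have heval := mvfderiv_clm_apply hg (ContinuousLinearMap.apply ℝ F w) X
  simp only [ContinuousLinearMap.apply_apply] at heval
  rw [heval] at htr
  rw [hev.self_of_nhds, map_neg]
  change _ = _ + -((trivializationAt F E x₁).coordChangeL ℝ (trivializationAt F E x₀) (c s)
        (connectionForm cov x₁ (c s) X w))
  rw [htr]
  change -(connectionForm cov x₀ (c s) X (g (c s) w)) = mvfderiv (𝓡 d) g (c s) X w +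
    -(mvfderiv (𝓡 d) g (c s) X w + connectionForm cov x₀ (c s) X (g (c s) w))
  abel

variable [T2Space M]

/-- The connection form along a smooth map is continuous. -/
theorem exists_continuousOn_connectionForm (cov : CovariantDerivative (𝓡 d) F E)
    (hcov : CovariantDerivative.ContMDiffCovariantDerivative cov ∞)
    {V : Type*} [NormedAddCommGroup V] [NormedSpace ℝ V] [FiniteDimensional ℝ V]
    {U : Set V} (hU : IsOpen U) {f : V → M} (hf : ContMDiffOn 𝓘(ℝ, V) (𝓡 d) ∞ f U)
    {z₀ : V} (hz₀ : z₀ ∈ U) :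
    ∃ W : Set V, IsOpen W ∧ z₀ ∈ W ∧ W ⊆ U ∧
      (∀ z ∈ W, f z ∈ (trivializationAt F E (f z₀)).baseSet) ∧
      ∃ H : V → V →L[ℝ] F →L[ℝ] F, ContinuousOn H W ∧ ∀ z ∈ W, ∀ (Z : V) (v : F),
        H z Z v = connectionForm cov (f z₀) (f z) (mfderiv 𝓘(ℝ, V) (𝓡 d) f z Z) v := by
  set e := trivializationAt F E (f z₀) with he
  set b := Module.finBasis ℝ F with hb
  have hx₀ : f z₀ ∈ e.baseSet := mem_baseSet_trivializationAt F E (f z₀)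
  -- Smoothness of `cov` is applied to global sections, while the frame lives on the base set only.
  -- The frame is cut off by a bump function equal to 1 on `N`, which by locality does not change
  -- its covariant derivative over `N`.
  obtain ⟨ρ, -, hρ⟩ := (SmoothBumpFunction.nhds_basis_tsupport (I := 𝓡 d) (f z₀)).mem_iff.1
    (e.open_baseSet.mem_nhds hx₀)
  obtain ⟨N, hN, hNo, hzN⟩ := eventually_nhds_iff.1 ρ.eventuallyEq_one
  let S : Fin (Module.finrank ℝ F) → ∀ y, E y := fun a =>
    (ρ : M → ℝ) • fun y => e.symm y (b a)
  have hS : ∀ a, ContMDiff (𝓡 d) ((𝓡 d).prod 𝓘(ℝ, F)) ∞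
      (fun y => (⟨y, S a y⟩ : TotalSpace F E)) := fun a =>
    ContMDiffOn.smul_section_of_tsupport ρ.contMDiff.contMDiffOn e.open_baseSet hρ
      (contMDiffOn_trivialization_symm _ _)
  have hfc := hf.continuousOn
  refine ⟨U ∩ f ⁻¹' (N ∩ e.baseSet), hfc.isOpen_inter_preimage hU (hNo.inter e.open_baseSet),
    ⟨hz₀, hzN, hx₀⟩, inter_subset_left, fun z hz => hz.2.2, ?_⟩
  set W := U ∩ f ⁻¹' (N ∩ e.baseSet) with hW
  have hWo : IsOpen W := hfc.isOpen_inter_preimage hU (hNo.inter e.open_baseSet)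
  refine ⟨fun z => (connectionForm cov (f z₀) (f z)).comp (mfderiv 𝓘(ℝ, V) (𝓡 d) f z), ?_,
    fun z _ Z v => rfl⟩
  refine continuousOn_clm_apply.2 fun Z => continuousOn_clm_apply.2 fun v => ?_
  have hfW : ContMDiffOn 𝓘(ℝ, V) (𝓡 d) ∞ f W := hf.mono inter_subset_left
  have htan : ContMDiffOn 𝓘(ℝ, V) ((𝓡 d).prod 𝓘(ℝ, EuclideanSpace ℝ (Fin d))) ∞
      (fun z => (⟨f z, mfderiv 𝓘(ℝ, V) (𝓡 d) f z Z⟩ : TangentBundle (𝓡 d) M)) W := by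
    have h₁ := hfW.contMDiffOn_tangentMapWithin (m := ∞) (by simp) hWo.uniqueMDiffOn
    have h₂ : ContMDiff 𝓘(ℝ, V) (𝓘(ℝ, V).prod 𝓘(ℝ, V)) ∞
        (fun z : V => (⟨z, Z⟩ : TangentBundle 𝓘(ℝ, V) V)) :=
      contMDiff_vectorSpace_iff_contDiff.2 contDiff_const
    refine (h₁.comp h₂.contMDiffOn (s := W) fun z hz => hz).congr fun z hz => ?_
    simp only [Function.comp_apply, tangentMapWithin]
    rw [mfderivWithin_of_isOpen hWo hz]
  have hcovS : ∀ a, ContinuousOn (fun z => (e (⟨f z, cov (S a) (f z)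
      (mfderiv 𝓘(ℝ, V) (𝓡 d) f z Z)⟩ : TotalSpace F E)).2) W := by
    intro a
    have h₁ := hcov.contMDiff.contMDiff (σ := S a) (hS a).contMDiffOn
    have h₂ := ContMDiffOn.clm_bundle_apply (h₁.comp hfW fun z _ => mem_univ _) htan
    exact continuous_snd.comp_continuousOn (e.continuousOn.comp h₂.continuousOn fun z hz =>
      e.mem_source.2 hz.2.2)
  refine ContinuousOn.congr (f := fun z => ∑ a, b.repr v a • (e (⟨f z, cov (S a) (f z)
      (mfderiv 𝓘(ℝ, V) (𝓡 d) f z Z)⟩ : TotalSpace F E)).2)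
    (continuousOn_finsetSum _ fun a _ => (hcovS a).const_smul _) fun z hz => ?_
  refine (connectionForm_apply _ _ _ _ _).trans (Finset.sum_congr rfl fun a _ => ?_)
  rw [← Trivialization.continuousLinearMapAt_apply_of_mem ℝ e hz.2.2]
  congr 3
  refine cov.isCovariantDerivativeOnUniv.congr_of_eventuallyEq
    (mdifferentiableAt_trivialization_symm hz.2.2 mdifferentiableAt_const)
    ((hS a).mdifferentiable (by simp) _) Filter.univ_mem ?_
  filter_upwards [hNo.mem_nhds hz.2.1] with y hy
  simp [S, hN y hy]
  rfl

end Connection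

/-! ### Linear differential equations -/

section LinearODE

open MeasureTheory

variable {F : Type*} [NormedAddCommGroup F] [NormedSpace ℝ F] [CompleteSpace F]

/-- Picard–Lindelöf on the ball of radius `‖v‖ + 1` about `v`: the field is bounded there by `K
(2‖v‖ + 1)`, and `K (b - a) ≤ 1 / 2` keeps the solution inside. By linearity the admissible length
of the interval does not depend on `v`. -/
theorem exists_linear_ode {A : ℝ → F →L[ℝ] F} {a b K : ℝ} (hA : ContinuousOn A (Icc a b))
    (hK : 0 ≤ K) (hAK : ∀ s ∈ Icc a b, ‖A s‖ ≤ K) (hab : K * (b - a) ≤ 1 / 2) {s₀ : ℝ}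
    (hs₀ : s₀ ∈ Icc a b) (v : F) :
    ∃ w : ℝ → F, w s₀ = v ∧ ∀ s ∈ Icc a b, HasDerivWithinAt w (A s (w s)) (Icc a b) s := by
  lift K to NNReal using hK
  have hv := norm_nonneg v
  refine IsPicardLindelof.exists_eq_forall_mem_Icc_hasDerivWithinAt (t₀ := ⟨s₀, hs₀⟩) (x₀ := v)
    (f := fun s x => A s x) (a := ‖v‖₊ + 1) (r := 0) (L := K * (2 * ‖v‖₊ + 1)) (K := K)
    ⟨?_, ?_, ?_, ?_⟩ (by simp)
  · exact fun s hs => ((A s).lipschitz.weaken (hAK s hs)).lipschitzOnWith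
  · exact fun x _ => hA.clm_apply continuousOn_const
  · intro s hs x hx
    rw [mem_closedBall_iff_norm] at hx
    push_cast at hx ⊢
    refine (A s).le_of_opNorm_le_of_le (hAK s hs) ?_
    have := norm_le_norm_add_norm_sub' x v
    linarith
  · push_cast
    have hmax : max (b - s₀) (s₀ - a) ≤ b - a :=
      max_le (by linarith [hs₀.1]) (by linarith [hs₀.2])
    have h₁ : (K : ℝ) * max (b - s₀) (s₀ - a) ≤ 1 / 2 :=
      (mul_le_mul_of_nonneg_left hmax K.2).trans hab
    calc (K : ℝ) * (2 * ‖v‖ + 1) * max (b - s₀) (s₀ - a)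
        = (2 * ‖v‖ + 1) * (K * max (b - s₀) (s₀ - a)) := by ring
      _ ≤ (2 * ‖v‖ + 1) * (1 / 2) := by gcongr
      _ ≤ ‖v‖ + 1 - 0 := by linarith

/-- A bound for the solutions of a linear differential inequality on a short interval. -/
theorem norm_le_of_norm_deriv_le {z : ℝ → F} {e : ℝ → ℝ} {a b K : ℝ}
    (hz : ContinuousOn z (Icc a b)) {S : Set ℝ} (hS : S.Countable)
    (hz' : ∀ s ∈ Ioo a b \ S, ∃ z', HasDerivAt z z' s ∧ ‖z'‖ ≤ K * ‖z s‖ + e s)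
    (he : IntegrableOn e (Ioc a b)) (hK : 0 ≤ K) (hab : K * (b - a) ≤ 1 / 2)
    {s₁ s₂ : ℝ} (hs₁ : s₁ ∈ Icc a b) (hs₂ : s₂ ∈ Icc a b) :
    ‖z s₂‖ ≤ 2 * (‖z s₁‖ + ∫ s in Ioc a b, e s) := by
  have hle : a ≤ b := hs₁.1.trans hs₁.2
  -- Let `‖z‖` be maximal at `m`. Integration from `s₁` to `m` gives `‖z m‖ ≤ ‖z s₁‖ + ‖z m‖ / 2 + ∫
  -- e`, and the middle term is absorbed on the left.
  obtain ⟨m, hm, hmax⟩ := isCompact_Icc.exists_isMaxOn ⟨s₁, hs₁⟩ hz.norm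
  replace hmax : ∀ s ∈ Icc a b, ‖z s‖ ≤ ‖z m‖ := hmax
  have hd : ∀ s ∈ Ioo a b \ S, HasDerivAt z (deriv z s) s := fun s hs => by
    obtain ⟨z', h, -⟩ := hz' s hs
    exact h.differentiableAt.hasDerivAt
  have hnull : ∀ᵐ s ∂volume, s ∉ insert b S :=
    (hS.insert b).ae_notMem volume
  have hbd : ∀ᵐ s ∂volume.restrict (Ioc a b), ‖deriv z s‖ ≤ K * ‖z m‖ + e s := by
    rw [ae_restrict_iff' measurableSet_Ioc]
    filter_upwards [hnull] with s hs hsab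
    have hsb : s ≠ b := fun h => hs (Or.inl h)
    have hsI : s ∈ Ioo a b := ⟨hsab.1, hsab.2.lt_of_ne hsb⟩
    obtain ⟨z', h, h'⟩ := hz' s ⟨hsI, fun h => hs (Or.inr h)⟩
    rw [h.deriv]
    exact h'.trans (by gcongr; exact hmax s (Ioo_subset_Icc_self hsI))
  have hint : IntegrableOn (fun s => K * ‖z m‖ + e s) (Ioc a b) :=
    (integrableOn_const (by simp)).add he
  have hdint : IntegrableOn (deriv z) (Ioc a b) :=
    hint.mono' (aestronglyMeasurable_deriv _ _) hbd
  have hsub : uIoc s₁ m ⊆ Ioc a b :=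
    Ioc_subset_Ioc (le_min hs₁.1 hm.1) (max_le hs₁.2 hm.2)
  have hftc : ∫ s in s₁..m, deriv z s = z m - z s₁ := by
    refine integral_eq_of_hasDerivAt_off_countable z (deriv z) hS
      (hz.mono (uIcc_subset_Icc hs₁ hm)) (fun s hs => hd s ⟨?_, hs.2⟩) ?_
    · exact Ioo_subset_Ioo (le_min hs₁.1 hm.1) (max_le hs₁.2 hm.2) hs.1
    · exact intervalIntegrable_iff.2 (hdint.mono_set hsub)
  have h₁ : ‖z m - z s₁‖ ≤ K * ‖z m‖ * (b - a) + ∫ s in Ioc a b, e s := by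
    rw [← hftc]
    calc ‖∫ s in s₁..m, deriv z s‖ ≤ ∫ s in uIoc s₁ m, ‖deriv z s‖ :=
          intervalIntegral.norm_integral_le_integral_norm_uIoc
      _ ≤ ∫ s in Ioc a b, ‖deriv z s‖ :=
          setIntegral_mono_set hdint.norm (ae_of_all _ fun _ => norm_nonneg _) hsub.eventuallyLE
      _ ≤ ∫ s in Ioc a b, (K * ‖z m‖ + e s) := integral_mono_ae hdint.norm hint hbd
      _ = K * ‖z m‖ * (b - a) + ∫ s in Ioc a b, e s := by
          have hc : Integrable (fun _ : ℝ => K * ‖z m‖) (volume.restrict (Ioc a b)) :=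
            integrableOn_const (by simp)
          rw [integral_add hc he]
          simp [hle, mul_comm]
  have h₂ : ‖z m‖ ≤ ‖z s₁‖ + ‖z m - z s₁‖ := norm_le_norm_add_norm_sub' _ _
  have h₃ : K * ‖z m‖ * (b - a) ≤ ‖z m‖ / 2 := by
    calc K * ‖z m‖ * (b - a) = ‖z m‖ * (K * (b - a)) := by ring
      _ ≤ ‖z m‖ * (1 / 2) := by gcongr
      _ = ‖z m‖ / 2 := by ring
  linarith [hmax s₂ hs₂]

/-- Solutions of linear differential equations depend continuously on the equation and on the
initial value. -/
theorem tendsto_linear_ode {Q : Type*} {l : Filter Q} [l.IsCountablyGenerated]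
    {A : Q → ℝ → F →L[ℝ] F} {A₀ : ℝ → F →L[ℝ] F} {w : Q → ℝ → F} {w₀ : ℝ → F} {a b K : ℝ}
    (hK : 0 ≤ K) (hab : K * (b - a) ≤ 1 / 2)
    (hw : ∀ᶠ q in l, ContinuousOn (w q) (Icc a b)) (hw₀ : ContinuousOn w₀ (Icc a b))
    (hw' : ∀ᶠ q in l, ∃ S : Set ℝ, S.Countable ∧
      ∀ s ∈ Ioo a b \ S, HasDerivAt (w q) (A q s (w q s)) s)
    (hw₀' : ∃ S : Set ℝ, S.Countable ∧ ∀ s ∈ Ioo a b \ S, HasDerivAt w₀ (A₀ s (w₀ s)) s)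
    (hA : ∀ᶠ q in l, AEStronglyMeasurable (A q) (volume.restrict (Ioc a b)))
    (hA₀ : AEStronglyMeasurable A₀ (volume.restrict (Ioc a b)))
    (hAK : ∀ᶠ q in l, ∀ s ∈ Ioo a b, ‖A q s‖ ≤ K) (hA₀K : ∀ s ∈ Ioo a b, ‖A₀ s‖ ≤ K)
    (hlim : ∃ S : Set ℝ, S.Countable ∧
      ∀ s ∈ Ioo a b \ S, Filter.Tendsto (fun q => A q s) l (𝓝 (A₀ s)))
    {s₁ s₂ : ℝ} (hs₁ : s₁ ∈ Icc a b) (hs₂ : s₂ ∈ Icc a b)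
    (h : Filter.Tendsto (fun q => w q s₁) l (𝓝 (w₀ s₁))) :
    Filter.Tendsto (fun q => w q s₂) l (𝓝 (w₀ s₂)) := by
  have hle : a ≤ b := hs₁.1.trans hs₁.2
  obtain ⟨C, hC⟩ := isCompact_Icc.exists_bound_of_continuousOn hw₀
  have hC₀ : 0 ≤ C := (norm_nonneg _).trans (hC s₁ hs₁)
  obtain ⟨S₀, hS₀, hS₀'⟩ := hw₀'
  obtain ⟨S₁, hS₁, hS₁'⟩ := hlim
  -- The difference `z = w q - w₀` satisfies `z' = A q z + (A q - A₀) w₀`. Here `e q` bounds the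
  -- inhomogeneous term, and its integral tends to 0 by dominated convergence.
  let e : Q → ℝ → ℝ := fun q s => ‖A q s - A₀ s‖ * C
  have hemeas : ∀ᶠ q in l, AEStronglyMeasurable (e q) (volume.restrict (Ioc a b)) := by
    filter_upwards [hA] with q hq using (hq.sub hA₀).norm.mul_const C
  have hebd : ∀ᶠ q in l, ∀ᵐ s ∂volume.restrict (Ioc a b), ‖e q s‖ ≤ 2 * K * C := by
    filter_upwards [hAK] with q hq
    rw [ae_restrict_iff' measurableSet_Ioc]
    filter_upwards [(countable_singleton b).ae_notMem volume] with s hs hsab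
    have hsI : s ∈ Ioo a b := ⟨hsab.1, hsab.2.lt_of_ne hs⟩
    rw [Real.norm_of_nonneg (by positivity)]
    have := norm_sub_le (A q s) (A₀ s)
    have h1 := hq s hsI
    have h2 := hA₀K s hsI
    exact mul_le_mul_of_nonneg_right (by linarith) hC₀
  have heint : ∀ᶠ q in l, IntegrableOn (e q) (Ioc a b) := by
    filter_upwards [hemeas, hebd] with q hq hq'
    exact (integrableOn_const (by simp)).mono' hq hq'
  have helim : Filter.Tendsto (fun q => ∫ s in Ioc a b, e q s) l (𝓝 (∫ s in Ioc a b, (0 : ℝ))) := by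
    refine tendsto_integral_filter_of_dominated_convergence (fun _ => 2 * K * C) hemeas hebd
      (integrableOn_const (by simp)) ?_
    rw [ae_restrict_iff' measurableSet_Ioc]
    filter_upwards [(hS₁.insert b).ae_notMem volume] with s hs hsab
    have hsI : s ∈ Ioo a b := ⟨hsab.1, hsab.2.lt_of_ne fun h => hs (Or.inl h)⟩
    have := ((hS₁' s ⟨hsI, fun h => hs (Or.inr h)⟩).sub_const (A₀ s)).norm.mul_const C
    simpa using this
  rw [integral_zero] at helim
  rw [tendsto_iff_norm_sub_tendsto_zero] at h ⊢
  have hlim₂ : Filter.Tendsto (fun q => 2 * (‖w q s₁ - w₀ s₁‖ + ∫ s in Ioc a b, e q s)) l (𝓝 0) := by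
    simpa using (h.add helim).const_mul 2
  refine squeeze_zero' (Filter.Eventually.of_forall fun _ => norm_nonneg _) ?_ hlim₂
  filter_upwards [hw, hw', hAK, heint] with q hq ⟨S, hS, hS'⟩ hqK hqe
  refine norm_le_of_norm_deriv_le (z := fun s => w q s - w₀ s) (hq.sub hw₀) (hS.union hS₀)
    (fun s hs => ?_) hqe hK hab hs₁ hs₂
  refine ⟨_, (hS' s ⟨hs.1, fun h => hs.2 (Or.inl h)⟩).sub (hS₀' s ⟨hs.1, fun h => hs.2 (Or.inr h)⟩),
    ?_⟩
  have : A q s (w q s) - A₀ s (w₀ s) = A q s (w q s - w₀ s) + (A q s - A₀ s) (w₀ s) := by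
    simp
  rw [this]
  refine (norm_add_le _ _).trans (add_le_add ?_ ?_)
  · exact (A q s).le_of_opNorm_le (hqK s hs.1) _
  · exact (A q s - A₀ s).le_opNorm_of_le (hC s (Ioo_subset_Icc_self hs.1))

/-- A transitive relation which holds locally on an interval holds between its endpoints. -/
theorem rel_of_forall_exists_local {R : ℝ → ℝ → Prop} {a b : ℝ} (hab : a ≤ b)
    (htrans : ∀ x y z, a ≤ x → x ≤ y → y ≤ z → z ≤ b → R x y → R y z → R x z)
    (hloc : ∀ c ∈ Icc a b, ∃ δ > 0, (∀ x ∈ Icc a b, x ∈ Ioc (c - δ) c → R x c) ∧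
      ∀ x ∈ Icc a b, x ∈ Ico c (c + δ) → R c x) : R a b := by
  -- Points related to `a`. The supremum of `T` is related to `a` by the local hypothesis on its
  -- left, and is `b` by the one on its right.
  let T : Set ℝ := Icc a b ∩ Set.ofPred (R a)
  obtain ⟨δ₀, hδ₀, -, h₀⟩ := hloc a ⟨le_rfl, hab⟩
  have haT : a ∈ T := ⟨⟨le_rfl, hab⟩, h₀ a ⟨le_rfl, hab⟩ ⟨le_rfl, by linarith⟩⟩
  have hbdd : BddAbove T := ⟨b, fun x hx => hx.1.2⟩
  set c := sSup T with hc
  have hac : a ≤ c := le_csSup hbdd haT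
  have hcb : c ≤ b := csSup_le ⟨a, haT⟩ fun x hx => hx.1.2
  obtain ⟨δ, hδ, hl, hr⟩ := hloc c ⟨hac, hcb⟩
  obtain ⟨x, hxT, hx⟩ := exists_lt_of_lt_csSup ⟨a, haT⟩ (by linarith : c - δ < sSup T)
  have hxc : x ≤ c := le_csSup hbdd hxT
  have hRc : R a c := htrans a x c le_rfl hxT.1.1 hxc hcb hxT.2 (hl x hxT.1 ⟨hx, hxc⟩)
  rcases hcb.eq_or_lt with h | h
  · rwa [← h]
  · exfalso
    have hy : min b (c + δ / 2) ∈ T := by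
      have h₁ : c ≤ min b (c + δ / 2) := le_min hcb (by linarith)
      have h₂ : min b (c + δ / 2) ∈ Icc a b := ⟨hac.trans h₁, min_le_left _ _⟩
      exact ⟨h₂, htrans a c _ le_rfl hac h₁ h₂.2 hRc
        (hr _ h₂ ⟨h₁, (min_le_right _ _).trans_lt (by linarith)⟩)⟩
    have := le_csSup hbdd hy
    have : c < min b (c + δ / 2) := lt_min h (by linarith)
    linarith

end LinearODE

/-! ### Parallel lifts -/

section ParallelLift

variable {d : ℕ} {M : Type*} [TopologicalSpace M] [ChartedSpace (EuclideanSpace ℝ (Fin d)) M]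
  [IsManifold (𝓡 d) ∞ M]
  {F : Type*} [NormedAddCommGroup F] [NormedSpace ℝ F] [FiniteDimensional ℝ F]
  {E : M → Type*} [TopologicalSpace (TotalSpace F E)]
  [∀ x, AddCommGroup (E x)] [∀ x, Module ℝ (E x)] [∀ x, TopologicalSpace (E x)]
  [∀ x, IsTopologicalAddGroup (E x)] [∀ x, ContinuousSMul ℝ (E x)]
  [FiberBundle F E] [VectorBundle ℝ F E] {cov : CovariantDerivative (𝓡 d) F E}

/-- The equation of parallel lifts at the parameter `s`. -/
def IsParallelAt (cov : CovariantDerivative (𝓡 d) F E) (c : ℝ → M) (u : ℝ → TotalSpace F E)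
    (s : ℝ) : Prop :=
  MDifferentiableAt 𝓘(ℝ, ℝ) (𝓡 d) c s ∧
    HasDerivAt (fun r => (trivializationAt F E (c s) (u r)).2)
      (-(connectionForm cov (c s) (c s) (mfderiv 𝓘(ℝ, ℝ) (𝓡 d) c s (1 : ℝ))
        (trivializationAt F E (c s) (u s)).2)) s

/-- The point and the velocity are separate variables tied by equations, so that tangent spaces at
equal points need not be identified by casts. -/
theorem isParallelAt_of_hasMFDerivAt {c : ℝ → M} {u : ℝ → TotalSpace F E} {s : ℝ} {x : M}
    (hx : c s = x) {L : ℝ →L[ℝ] EuclideanSpace ℝ (Fin d)}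
    (hc : HasMFDerivAt 𝓘(ℝ, ℝ) (𝓡 d) c s L) {X : TangentSpace (𝓡 d) x} (hX : L 1 = X)
    (h : HasDerivAt (fun r => (trivializationAt F E x (u r)).2)
      (-(connectionForm cov x x X (trivializationAt F E x (u s)).2)) s) :
    IsParallelAt cov c u s := by
  subst hx hX
  refine ⟨hc.mdifferentiableAt, ?_⟩
  rw [hc.mfderiv]
  exact h

theorem IsParallelAt.congr {c c' : ℝ → M} {u u' : ℝ → TotalSpace F E} {s : ℝ}
    (h : IsParallelAt cov c u s) (hc : c' =ᶠ[𝓝 s] c) (hu : u' =ᶠ[𝓝 s] u) :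
    IsParallelAt cov c' u' s := by
  refine isParallelAt_of_hasMFDerivAt hc.self_of_nhds
    (h.1.hasMFDerivAt.congr_of_eventuallyEq hc) rfl ?_
  rw [hu.self_of_nhds]
  exact h.2.congr_of_eventuallyEq (hu.fun_comp fun z => (trivializationAt F E (c s) z).2)

theorem IsParallelAt.comp_sub_const {c : ℝ → M} {u : ℝ → TotalSpace F E} {s r : ℝ}
    (h : IsParallelAt cov c u (s - r)) :
    IsParallelAt cov (fun s => c (s - r)) (fun s => u (s - r)) s := by
  have hs : HasMFDerivAt 𝓘(ℝ, ℝ) 𝓘(ℝ, ℝ) (fun s : ℝ => s - r) s (ContinuousLinearMap.id ℝ ℝ) :=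
    ((hasFDerivAt_id s).sub_const r).hasMFDerivAt
  exact isParallelAt_of_hasMFDerivAt rfl (h.1.hasMFDerivAt.comp s hs) rfl
    (h.2.comp_sub_const s r)

theorem isParallelAt_const (u : TotalSpace F E) (s : ℝ) :
    IsParallelAt cov (fun _ => u.proj) (fun _ => u) s := by
  refine isParallelAt_of_hasMFDerivAt rfl (hasMFDerivAt_const _ _) (X := 0) rfl ?_
  simpa using hasDerivAt_const s _

theorem isParallelLift_iff {c : ℝ → M} {a b : ℝ} {u : ℝ → TotalSpace F E} :
    IsParallelLift cov c a b u ↔ (∀ s, (u s).proj = c s) ∧ ContinuousOn u (Icc a b) ∧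
      ∃ S : Set ℝ, S.Finite ∧ ∀ s ∈ Ioo a b \ S, IsParallelAt cov c u s := Iff.rfl

theorem IsParallelLift.mono {c : ℝ → M} {a b a' b' : ℝ} {u : ℝ → TotalSpace F E}
    (h : IsParallelLift cov c a b u) (ha : a ≤ a') (hb : b' ≤ b) :
    IsParallelLift cov c a' b' u := by
  obtain ⟨h₁, h₂, S, hS, h₃⟩ := h
  exact ⟨h₁, h₂.mono (Icc_subset_Icc ha hb), S, hS,
    fun s hs => h₃ s ⟨Ioo_subset_Ioo ha hb hs.1, hs.2⟩⟩

theorem IsParallelLift.comp_sub_const {c : ℝ → M} {a b : ℝ} {u : ℝ → TotalSpace F E}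
    (h : IsParallelLift cov c a b u) (r : ℝ) :
    IsParallelLift cov (fun s => c (s - r)) (a + r) (b + r) (fun s => u (s - r)) := by
  obtain ⟨h₁, h₂, S, hS, h₃⟩ := isParallelLift_iff.1 h
  refine isParallelLift_iff.2 ⟨fun s => h₁ _, h₂.comp (by fun_prop) fun s hs =>
    ⟨by linarith [hs.1], by linarith [hs.2]⟩, (fun s => s - r) ⁻¹' S,
    hS.preimage (sub_left_injective.injOn), fun s hs => (h₃ (s - r) ⟨?_, hs.2⟩).comp_sub_const⟩
  exact ⟨by linarith [hs.1.1], by linarith [hs.1.2]⟩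

/-- Parallel lifts over adjacent intervals can be glued. -/
theorem IsParallelLift.glue {c c₁ c₂ : ℝ → M} {a b e : ℝ} {u₁ u₂ : ℝ → TotalSpace F E}
    (h₁ : IsParallelLift cov c₁ a b u₁) (h₂ : IsParallelLift cov c₂ b e u₂)
    (hc₁ : ∀ s ≤ b, c s = c₁ s) (hc₂ : ∀ s ≥ b, c s = c₂ s) (hu : u₁ b = u₂ b) :
    IsParallelLift cov c a e (fun s => if s ≤ b then u₁ s else u₂ s) := by
  obtain ⟨p₁, q₁, S₁, hS₁, r₁⟩ := isParallelLift_iff.1 h₁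
  obtain ⟨p₂, q₂, S₂, hS₂, r₂⟩ := isParallelLift_iff.1 h₂
  -- The joint `b` joins the exceptional set, since the glued curve may have a corner there.
  refine isParallelLift_iff.2 ⟨fun s => ?_, ?_, insert b (S₁ ∪ S₂), (hS₁.union hS₂).insert b,
    fun s hs => ?_⟩
  · split_ifs with h
    · rw [p₁, hc₁ s h]
    · rw [p₂, hc₂ s (not_le.1 h).le]
  · refine ContinuousOn.mono (ContinuousOn.union_of_isClosed (s := Icc a b) (t := Icc b e)
      (q₁.congr fun s hs => if_pos hs.2) (q₂.congr fun s hs => ?_) isClosed_Icc isClosed_Icc)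
      fun s hs => ?_
    · split_ifs with h
      · rw [le_antisymm h hs.1, hu]
      · rfl
    · exact (le_total s b).imp (fun h => ⟨hs.1, h⟩) fun h => ⟨h, hs.2⟩
  · have hsb : s ≠ b := fun h => hs.2 (Or.inl h)
    rcases hsb.lt_or_gt with h | h
    · refine (r₁ s ⟨⟨hs.1.1, h⟩, fun h => hs.2 (Or.inr (Or.inl h))⟩).congr ?_ ?_
      · filter_upwards [gt_mem_nhds h] with r hr using hc₁ r hr.le
      · filter_upwards [gt_mem_nhds h] with r hr using if_pos hr.le
    · refine (r₂ s ⟨⟨h, hs.1.2⟩, fun h => hs.2 (Or.inr (Or.inr h))⟩).congr ?_ ?_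
      · filter_upwards [lt_mem_nhds h] with r hr using hc₂ r hr.le
      · filter_upwards [lt_mem_nhds h] with r hr using if_neg hr.not_ge

theorem isParallelLift_const (z : TotalSpace F E) (a b : ℝ) :
    IsParallelLift cov (fun _ => z.proj) a b fun _ => z :=
  isParallelLift_iff.2 ⟨fun _ => rfl, continuousOn_const, ∅, finite_empty,
    fun s _ => isParallelAt_const z s⟩

/-- Parallel lifts extend over intervals on which the curve is constant. -/
theorem IsParallelLift.exists_extend {c : ℝ → M} {a b : ℝ} {u : ℝ → TotalSpace F E}
    (h : IsParallelLift cov c a b u) (hab : a ≤ b) (hc : ∀ s ≥ b, c s = c b) (e : ℝ) :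
    ∃ u', IsParallelLift cov c a e u' ∧ u' a = u a ∧ ∀ s ≥ b, u' s = u b := by
  refine ⟨_, h.glue (isParallelLift_const (u b) b e) (fun _ _ => rfl)
    (fun s hs => (hc s hs).trans (h.1 b).symm) rfl, if_pos hab, fun s hs => ?_⟩
  split_ifs with h
  · rw [le_antisymm h hs]
  · rfl

/-- The equation is linear in the fibre coordinate. The lifts are given as sections along `c` so
that their values lie in a common fibre and can be added. -/
theorem IsParallelLift.smul_add {c : ℝ → M} {a b : ℝ} {U V : ∀ s, E (c s)}
    (hU : IsParallelLift cov c a b fun s => ⟨c s, U s⟩)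
    (hV : IsParallelLift cov c a b fun s => ⟨c s, V s⟩) (r : ℝ) :
    IsParallelLift cov c a b fun s => ⟨c s, r • U s + V s⟩ := by
  have hlin : ∀ (x₀ x : M), x ∈ (trivializationAt F E x₀).baseSet → ∀ v w : E x,
      (trivializationAt F E x₀ ⟨x, r • v + w⟩).2 = r • (trivializationAt F E x₀ ⟨x, v⟩).2 +
        (trivializationAt F E x₀ ⟨x, w⟩).2 := by
    intro x₀ x hx v w
    simp only [← Trivialization.continuousLinearMapAt_apply_of_mem ℝ _ hx, map_add, map_smul]
  obtain ⟨-, q₁, S₁, hS₁, r₁⟩ := isParallelLift_iff.1 hU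
  obtain ⟨-, q₂, S₂, hS₂, r₂⟩ := isParallelLift_iff.1 hV
  refine isParallelLift_iff.2 ⟨fun _ => rfl, fun s hs => ?_, S₁ ∪ S₂, hS₁.union hS₂,
    fun s hs => ?_⟩
  · obtain ⟨hc, h₁⟩ := (FiberBundle.continuousWithinAt_totalSpace F _).1 (q₁ s hs)
    obtain ⟨-, h₂⟩ := (FiberBundle.continuousWithinAt_totalSpace F _).1 (q₂ s hs)
    refine (FiberBundle.continuousWithinAt_totalSpace F _).2 ⟨hc, ?_⟩
    refine ((h₁.const_smul r).add h₂).congr_of_eventuallyEq ?_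
      (hlin _ _ (mem_baseSet_trivializationAt F E (c s)) _ _)
    filter_upwards [hc.eventually_mem ((trivializationAt F E (c s)).open_baseSet.mem_nhds
      (mem_baseSet_trivializationAt F E (c s)))] with x hx using hlin _ _ hx _ _
  · obtain ⟨hc, h₁⟩ := r₁ s ⟨hs.1, fun h => hs.2 (Or.inl h)⟩
    obtain ⟨-, h₂⟩ := r₂ s ⟨hs.1, fun h => hs.2 (Or.inr h)⟩
    refine ⟨hc, ?_⟩
    have h₃ := ((h₁.const_smul r).add h₂).congr_of_eventuallyEq
      (f₁ := fun x => (trivializationAt F E (c s) ⟨c x, r • U x + V x⟩).2) (by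
        filter_upwards [hc.continuousAt.eventually_mem
          ((trivializationAt F E (c s)).open_baseSet.mem_nhds
            (mem_baseSet_trivializationAt F E (c s)))] with x hx using hlin _ _ hx _ _)
    convert! h₃ using 1
    rw [hlin _ _ (mem_baseSet_trivializationAt F E (c s)), map_add, map_smul, neg_add, smul_neg]

variable [ContMDiffVectorBundle ∞ F E (𝓡 d)]

/-- The equation is defined in the trivialization centred at `c s`, which moves with `s`; a fixed
trivialization is needed to have one equation on a whole interval. -/
theorem isParallelAt_iff_trivialization {c : ℝ → M} {u : ℝ → TotalSpace F E} {s : ℝ} {x₀ : M}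
    (hu : ∀ r, (u r).proj = c r) (hc : MDifferentiableAt 𝓘(ℝ, ℝ) (𝓡 d) c s)
    (h₀ : c s ∈ (trivializationAt F E x₀).baseSet) :
    IsParallelAt cov c u s ↔ HasDerivAt (fun r => (trivializationAt F E x₀ (u r)).2)
      (-(connectionForm cov x₀ (c s) (mfderiv 𝓘(ℝ, ℝ) (𝓡 d) c s (1 : ℝ))
        (trivializationAt F E x₀ (u s)).2)) s :=
  have hself := mem_baseSet_trivializationAt F E (c s)
  ⟨fun h => hasDerivAt_parallel_change cov hu hc h₀ hself h.2,
    fun h => ⟨hc, hasDerivAt_parallel_change cov hu hc hself h₀ h⟩⟩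

variable [T2Space M] {V : Type*} [NormedAddCommGroup V]
  [NormedSpace ℝ V] [FiniteDimensional ℝ V]

set_option synthInstance.maxHeartbeats 200000 in
/-- In a local trivialization, parallel lifts over the curves `f ∘ g` are the solutions of a
linear differential equation. -/
theorem exists_local_ode (cov : CovariantDerivative (𝓡 d) F E)
    (hcov : CovariantDerivative.ContMDiffCovariantDerivative cov ∞)
    {U : Set V} (hU : IsOpen U) {f : V → M} (hf : ContMDiffOn 𝓘(ℝ, V) (𝓡 d) ∞ f U)
    {z₀ : V} (hz₀ : z₀ ∈ U) :
    ∃ r > 0, ∃ K ≥ 0, ∃ H : V → V →L[ℝ] F →L[ℝ] F, Metric.ball z₀ r ⊆ U ∧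
      ContinuousOn H (Metric.ball z₀ r) ∧ (∀ z ∈ Metric.ball z₀ r, ‖H z‖ ≤ K) ∧
      (∀ z ∈ Metric.ball z₀ r, f z ∈ (trivializationAt F E (f z₀)).baseSet) ∧
      ∀ (g : ℝ → V) (u : ℝ → TotalSpace F E) (s : ℝ), (∀ r, (u r).proj = f (g r)) →
        g s ∈ Metric.ball z₀ r → DifferentiableAt ℝ g s →
        (IsParallelAt cov (fun r => f (g r)) u s ↔
          HasDerivAt (fun r => (trivializationAt F E (f z₀) (u r)).2)
            (-H (g s) (deriv g s) (trivializationAt F E (f z₀) (u s)).2) s) := by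
  obtain ⟨W, hW, hzW, hWU, hWb, H, hH, hH'⟩ := exists_continuousOn_connectionForm cov hcov hU hf hz₀
  obtain ⟨r₁, hr₁, hb₁⟩ := Metric.isOpen_iff.1 hW z₀ hzW
  have hHz : ContinuousAt H z₀ := hH.continuousAt (hW.mem_nhds hzW)
  have hHn : ContinuousAt (fun z => ‖H z‖) z₀ :=
    (continuous_norm (E := V →L[ℝ] F →L[ℝ] F)).continuousAt.comp hHz
  have hbd : ∀ᶠ z in 𝓝 z₀, ‖H z‖ < ‖H z₀‖ + 1 := hHn.eventually_lt_const (by linarith)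
  obtain ⟨r₂, hr₂, hb₂⟩ := Metric.eventually_nhds_iff_ball.1 hbd
  have hsub : Metric.ball z₀ (min r₁ r₂) ⊆ W :=
    (Metric.ball_subset_ball (min_le_left _ _)).trans hb₁
  refine ⟨min r₁ r₂, lt_min hr₁ hr₂, ‖H z₀‖ + 1, by positivity, H, hsub.trans hWU, hH.mono hsub,
    fun z hz => (hb₂ z (Metric.ball_subset_ball (min_le_right _ _) hz)).le,
    fun z hz => hWb z (hsub hz), fun g u s hu hgs hg => ?_⟩
  have hz := hsub hgs
  have hfd : MDifferentiableAt 𝓘(ℝ, V) (𝓡 d) f (g s) :=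
    (hf.contMDiffAt (hU.mem_nhds (hWU hz))).mdifferentiableAt (by simp)
  have hgm : HasMFDerivAt 𝓘(ℝ, ℝ) 𝓘(ℝ, V) g s (fderiv ℝ g s) := hg.hasFDerivAt.hasMFDerivAt
  have hc : HasMFDerivAt 𝓘(ℝ, ℝ) (𝓡 d) (fun r => f (g r)) s
      ((mfderiv 𝓘(ℝ, V) (𝓡 d) f (g s)).comp (fderiv ℝ g s)) := hfd.hasMFDerivAt.comp s hgm
  have hcd : mfderiv 𝓘(ℝ, ℝ) (𝓡 d) (fun r => f (g r)) s (1 : ℝ) =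
      mfderiv 𝓘(ℝ, V) (𝓡 d) f (g s) (deriv g s) := by
    rw [hc.mfderiv]
    rfl
  have hHs : H (g s) (deriv g s) (trivializationAt F E (f z₀) (u s)).2 =
      connectionForm cov (f z₀) (f (g s)) (mfderiv 𝓘(ℝ, ℝ) (𝓡 d) (fun r => f (g r)) s (1 : ℝ))
        (trivializationAt F E (f z₀) (u s)).2 :=
    (hH' (g s) hz (deriv g s) _).trans
      (congrArg (fun X => connectionForm cov (f z₀) (f (g s)) X _) hcd.symm)
  rw [hHs]
  exact isParallelAt_iff_trivialization hu hc.mdifferentiableAt (hWb _ hz)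

end ParallelLift

/-! ### Existence, uniqueness and continuous dependence of parallel lifts -/

section ParallelLift

open MeasureTheory

variable {d : ℕ} {M : Type*} [TopologicalSpace M] [ChartedSpace (EuclideanSpace ℝ (Fin d)) M]
  [IsManifold (𝓡 d) ∞ M]
  {F : Type*} [NormedAddCommGroup F] [NormedSpace ℝ F] [FiniteDimensional ℝ F]
  {E : M → Type*} [TopologicalSpace (TotalSpace F E)]
  [∀ x, AddCommGroup (E x)] [∀ x, Module ℝ (E x)] [∀ x, TopologicalSpace (E x)]
  [∀ x, IsTopologicalAddGroup (E x)] [∀ x, ContinuousSMul ℝ (E x)]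
  [FiberBundle F E] [VectorBundle ℝ F E] {cov : CovariantDerivative (𝓡 d) F E}
  [ContMDiffVectorBundle ∞ F E (𝓡 d)] [T2Space M] {V : Type*} [NormedAddCommGroup V]
  [NormedSpace ℝ V] [FiniteDimensional ℝ V]

set_option maxHeartbeats 1000000 in
set_option synthInstance.maxHeartbeats 200000 in
/-- In a local trivialization, parallel lifts over curves `f ∘ g` with `g` Lipschitz are the
solutions of a linear differential equation with bounded measurable coefficients. -/
theorem exists_local_ode_lipschitz (cov : CovariantDerivative (𝓡 d) F E)
    (hcov : CovariantDerivative.ContMDiffCovariantDerivative cov ∞)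
    {U : Set V} (hU : IsOpen U) {f : V → M} (hf : ContMDiffOn 𝓘(ℝ, V) (𝓡 d) ∞ f U)
    {z₀ : V} (hz₀ : z₀ ∈ U) (C : NNReal) :
    ∃ r > 0, ∃ K ≥ 0, ∃ H : V → V →L[ℝ] F →L[ℝ] F, Metric.ball z₀ r ⊆ U ∧
      (∀ z ∈ Metric.ball z₀ r, ContinuousAt H z) ∧
      (∀ z ∈ Metric.ball z₀ r, f z ∈ (trivializationAt F E (f z₀)).baseSet) ∧
      ∀ (g : ℝ → V) (u : ℝ → TotalSpace F E) (x y : ℝ), LipschitzWith C g →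
        (∃ S : Set ℝ, S.Countable ∧ ∀ s ∉ S, DifferentiableAt ℝ g s) →
        (∀ s ∈ Icc x y, g s ∈ Metric.ball z₀ r) →
        IsParallelLift cov (fun s => f (g s)) x y u →
        ContinuousOn (fun s => (trivializationAt F E (f z₀) (u s)).2) (Icc x y) ∧
        (∃ S : Set ℝ, S.Countable ∧ ∀ s ∈ Ioo x y \ S,
          HasDerivAt (fun s => (trivializationAt F E (f z₀) (u s)).2)
            ((-H (g s) (deriv g s)) (trivializationAt F E (f z₀) (u s)).2) s) ∧
        AEStronglyMeasurable (fun s => -H (g s) (deriv g s)) (volume.restrict (Ioc x y)) ∧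
        ∀ s ∈ Ioo x y, ‖-H (g s) (deriv g s)‖ ≤ K := by
  obtain ⟨r, hr, K, hK, H, hrU, hH, hHK, hrb, h⟩ := exists_local_ode cov hcov hU hf hz₀
  -- `K` bounds the connection form near `z₀`, and the Lipschitz constant `C` bounds the velocity of
  -- `g`.
  refine ⟨r, hr, K * C, by positivity, H, hrU,
    fun z hz => hH.continuousAt (Metric.isOpen_ball.mem_nhds hz), hrb,
    fun g u x y hg hd hgr hu => ?_⟩
  obtain ⟨hu₁, hu₂, S, hS, hu₃⟩ := isParallelLift_iff.1 hu
  obtain ⟨S', hS', hd⟩ := hd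
  refine ⟨?_, ⟨S ∪ S', hS.countable.union hS', fun s hs => ?_⟩, ?_, fun s hs => ?_⟩
  · refine continuous_snd.comp_continuousOn
      ((trivializationAt F E (f z₀)).continuousOn.comp hu₂ fun s hs => ?_)
    rw [Trivialization.mem_source, hu₁]
    exact hrb _ (hgr s hs)
  · exact (h g u s hu₁ (hgr s (Ioo_subset_Icc_self hs.1))
      (hd s fun h => hs.2 (Or.inr h))).1 (hu₃ s ⟨hs.1, fun h => hs.2 (Or.inl h)⟩)
  · have h₁ : AEStronglyMeasurable (fun s => H (g s)) (volume.restrict (Ioc x y)) :=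
      ((hH.comp hg.continuous.continuousOn hgr).mono
        Ioc_subset_Icc_self).aestronglyMeasurable measurableSet_Ioc
    have h₂ : AEStronglyMeasurable (deriv g) (volume.restrict (Ioc x y)) :=
      aestronglyMeasurable_deriv _ _
    have h₃ : AEStronglyMeasurable (fun s => H (g s) (deriv g s)) (volume.restrict (Ioc x y)) :=
      isBoundedBilinearMap_apply.continuous.comp_aestronglyMeasurable (h₁.prodMk h₂)
    exact h₃.neg
  · rw [norm_neg]
    exact (H (g s)).le_of_opNorm_le_of_le (hHK _ (hgr s (Ioo_subset_Icc_self hs)))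
      (norm_deriv_le_of_lipschitz hg)

set_option maxHeartbeats 1000000 in
set_option synthInstance.maxHeartbeats 200000 in
/-- Parallel lifts depend continuously on the curve and on the value at an endpoint. -/
theorem tendsto_parallelLift_iff (hcov : CovariantDerivative.ContMDiffCovariantDerivative cov ∞)
    {U : Set V} (hU : IsOpen U) {f : V → M} (hf : ContMDiffOn 𝓘(ℝ, V) (𝓡 d) ∞ f U)
    {Q : Type*} {l : Filter Q} [l.IsCountablyGenerated] {g : Q → ℝ → V} {g₀ : ℝ → V} {C : NNReal}
    (hg : ∀ q, LipschitzWith C (g q)) (hg₀ : LipschitzWith C g₀) (hgU : ∀ s, g₀ s ∈ U)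
    (hd : ∀ q, ∃ S : Set ℝ, S.Countable ∧ ∀ s ∉ S, DifferentiableAt ℝ (g q) s)
    (hd₀ : ∃ S : Set ℝ, S.Countable ∧ ∀ s ∉ S, DifferentiableAt ℝ g₀ s)
    (hlim : ∀ s, Filter.Tendsto (fun q => g q s) l (𝓝 (g₀ s)))
    (hlim' : ∃ S : Set ℝ, S.Countable ∧
      ∀ s ∉ S, Filter.Tendsto (fun q => deriv (g q) s) l (𝓝 (deriv g₀ s)))
    {u : Q → ℝ → TotalSpace F E} {u₀ : ℝ → TotalSpace F E} {a b : ℝ} (hab : a ≤ b)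
    (hu : ∀ q, IsParallelLift cov (fun s => f (g q s)) a b (u q))
    (hu₀ : IsParallelLift cov (fun s => f (g₀ s)) a b u₀) :
    Filter.Tendsto (fun q => u q a) l (𝓝 (u₀ a)) ↔
      Filter.Tendsto (fun q => u q b) l (𝓝 (u₀ b)) := by
  refine rel_of_forall_exists_local (R := fun x y => Filter.Tendsto (fun q => u q x) l (𝓝 (u₀ x)) ↔
      Filter.Tendsto (fun q => u q y) l (𝓝 (u₀ y))) hab
    (fun x y z _ _ _ _ h₁ h₂ => h₁.trans h₂) fun c hc => ?_
  suffices hs : ∃ δ > 0, ∀ x ∈ Icc a b, ∀ y ∈ Icc a b, x ≤ y → c ∈ Icc x y → y - x ≤ δ →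
      (Filter.Tendsto (fun q => u q x) l (𝓝 (u₀ x)) ↔
        Filter.Tendsto (fun q => u q y) l (𝓝 (u₀ y))) by
    obtain ⟨δ, hδ, h⟩ := hs
    exact ⟨δ, hδ, fun x hx hxc => h x hx c hc hxc.2 ⟨hxc.2, le_rfl⟩ (by linarith [hxc.1]),
      fun x hx hxc => h c hc x hx hxc.1 ⟨le_rfl, hxc.1⟩ (by linarith [hxc.2])⟩
  obtain ⟨r, hr, K, hK, H, hrU, hH, hrb, hode⟩ :=
    exists_local_ode_lipschitz cov hcov hU hf (hgU c) C
  set e := trivializationAt F E (f (g₀ c)) with he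
  -- `δ₁` gives the smallness required by the estimate for the equation. `δ₂` confines each curve to
  -- a ball of radius `r / 2` about its value at `c`; the other half of `r` allows for the distance
  -- from `g q c` to `g₀ c`.
  obtain ⟨δ₁, hδ₁, hδ₁K⟩ := exists_pos_mul_lt (by norm_num : (0 : ℝ) < 1 / 2) K
  obtain ⟨δ₂, hδ₂, hδ₂C⟩ := exists_pos_mul_lt (half_pos hr) (C : ℝ)
  refine ⟨min δ₁ δ₂, lt_min hδ₁ hδ₂, fun x hx y hy hxy hcxy hδ => ?_⟩
  have hKδ : K * (y - x) ≤ 1 / 2 :=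
    (mul_le_mul_of_nonneg_left (hδ.trans (min_le_left _ _)) hK).trans hδ₁K.le
  have hdist : ∀ g' : ℝ → V, LipschitzWith C g' → ∀ s ∈ Icc x y, dist (g' s) (g' c) < r / 2 := by
    intro g' hg' s hs
    refine (hg'.dist_le_mul s c).trans_lt (lt_of_le_of_lt ?_ hδ₂C)
    gcongr
    rw [Real.dist_eq, abs_le]
    have := hδ.trans (min_le_right _ _)
    constructor <;> linarith [hs.1, hs.2, hcxy.1, hcxy.2]
  have hball₀ : ∀ s ∈ Icc x y, g₀ s ∈ Metric.ball (g₀ c) r := fun s hs =>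
    Metric.mem_ball.2 ((hdist g₀ hg₀ s hs).trans (by linarith))
  have hball : ∀ᶠ q in l, ∀ s ∈ Icc x y, g q s ∈ Metric.ball (g₀ c) r := by
    filter_upwards [(hlim c).eventually (Metric.ball_mem_nhds (g₀ c) (half_pos hr))] with q hq s hs
    have h₁ := hdist (g q) (hg q) s hs
    have h₂ := dist_triangle (g q s) (g q c) (g₀ c)
    rw [Metric.mem_ball]
    linarith
  have hode₀ := hode g₀ u₀ x y hg₀ hd₀ hball₀ (hu₀.mono hx.1 hy.2)
  have hodeq : ∀ᶠ q in l, _ := hball.mono fun q hq =>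
    hode (g q) (u q) x y (hg q) (hd q) hq ((hu q).mono hx.1 hy.2)
  have hmem : ∀ s ∈ Icc x y, u₀ s ∈ e.source := fun s hs => by
    rw [Trivialization.mem_source, hu₀.1]
    exact hrb _ (hball₀ s hs)
  have hproj : ∀ s ∈ Icc x y,
      Filter.Tendsto (TotalSpace.proj ∘ fun q => u q s) l (𝓝 (u₀ s).proj) := fun s hs => by
    have : (TotalSpace.proj ∘ fun q => u q s) = fun q => f (g q s) := funext fun q => (hu q).1 s
    rw [this, hu₀.1]
    exact (hf.continuousOn.continuousAt (hU.mem_nhds (hgU s))).tendsto.comp (hlim s)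
  have hlim'' : ∃ S : Set ℝ, S.Countable ∧ ∀ s ∈ Ioo x y \ S, Filter.Tendsto
      (fun q => -H (g q s) (deriv (g q) s)) l (𝓝 (-H (g₀ s) (deriv g₀ s))) := by
    obtain ⟨S, hS, hS'⟩ := hlim'
    refine ⟨S, hS, fun s hs => ?_⟩
    have h₁ : Filter.Tendsto (fun q => H (g q s)) l (𝓝 (H (g₀ s))) :=
      (hH _ (hball₀ s (Ioo_subset_Icc_self hs.1))).tendsto.comp (hlim s)
    have h₂ : Filter.Tendsto (fun q => H (g q s) (deriv (g q) s)) l (𝓝 (H (g₀ s) (deriv g₀ s))) :=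
      (isBoundedBilinearMap_apply.continuous.tendsto _).comp (h₁.prodMk_nhds (hS' s hs.2))
    exact h₂.neg
  have key : ∀ s₁ ∈ Icc x y, ∀ s₂ ∈ Icc x y, Filter.Tendsto (fun q => u q s₁) l (𝓝 (u₀ s₁)) →
      Filter.Tendsto (fun q => u q s₂) l (𝓝 (u₀ s₂)) := by
    intro s₁ hs₁ s₂ hs₂ h
    -- Convergence in the total space splits into that of base points, already known, and that of
    -- fibre coordinates, governed by the differential equation.
    rw [e.tendsto_nhds_iff (hmem _ hs₁)] at h
    rw [e.tendsto_nhds_iff (hmem _ hs₂)]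
    exact ⟨hproj s₂ hs₂, tendsto_linear_ode (A := fun q s => -H (g q s) (deriv (g q) s))
      (A₀ := fun s => -H (g₀ s) (deriv g₀ s)) (w := fun q s => (e (u q s)).2)
      (w₀ := fun s => (e (u₀ s)).2) hK hKδ (hodeq.mono fun q hq => hq.1) hode₀.1
      (hodeq.mono fun q hq => hq.2.1) hode₀.2.1 (hodeq.mono fun q hq => hq.2.2.1) hode₀.2.2.1
      (hodeq.mono fun q hq => hq.2.2.2) hode₀.2.2.2 hlim'' hs₁ hs₂ h.2⟩
  exact ⟨key x ⟨le_rfl, hxy⟩ y ⟨hxy, le_rfl⟩, key y ⟨hxy, le_rfl⟩ x ⟨le_rfl, hxy⟩⟩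

/-- A parallel lift is determined by its value at either endpoint. -/
theorem IsParallelLift.eq_iff (hcov : CovariantDerivative.ContMDiffCovariantDerivative cov ∞)
    {U : Set V} (hU : IsOpen U) {f : V → M} (hf : ContMDiffOn 𝓘(ℝ, V) (𝓡 d) ∞ f U)
    {g : ℝ → V} {C : NNReal} (hg : LipschitzWith C g) (hgU : ∀ s, g s ∈ U)
    (hd : ∃ S : Set ℝ, S.Countable ∧ ∀ s ∉ S, DifferentiableAt ℝ g s)
    {u u' : ℝ → TotalSpace F E} {a b : ℝ} (hab : a ≤ b)
    (hu : IsParallelLift cov (fun s => f (g s)) a b u)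
    (hu' : IsParallelLift cov (fun s => f (g s)) a b u') : u a = u' a ↔ u b = u' b := by
  -- Uniqueness is continuous dependence for a constant family: along a principal filter at one
  -- point, convergence of `u s` to `u' s` means equality.
  have h := tendsto_parallelLift_iff hcov hU hf (l := (pure () : Filter Unit)) (fun _ => hg) hg hgU
    (fun _ => hd) hd (fun _ => tendsto_const_nhds)
    ⟨∅, countable_empty, fun _ _ => tendsto_const_nhds⟩ hab (fun _ => hu) hu'
  have key : ∀ s, Filter.Tendsto (fun _ : Unit => u s) (pure ()) (𝓝 (u' s)) ↔ u s = u' s := by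
    refine fun s => ⟨fun h => ?_, fun h => h ▸ tendsto_const_nhds⟩
    have hs := mem_baseSet_trivializationAt F E (f (g s))
    have h₁ : u s ∈ (trivializationAt F E (f (g s))).source := by
      rwa [Trivialization.mem_source, hu.1]
    have h₂ : u' s ∈ (trivializationAt F E (f (g s))).source := by
      rwa [Trivialization.mem_source, hu'.1]
    rw [(trivializationAt F E (f (g s))).tendsto_nhds_iff h₂] at h
    refine (trivializationAt F E (f (g s))).toOpenPartialHomeomorph.injOn h₁ h₂ (Prod.ext ?_ ?_)
    · exact ((trivializationAt F E (f (g s))).coe_fst h₁).trans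
        (((hu.1 s).trans (hu'.1 s).symm).trans
          ((trivializationAt F E (f (g s))).coe_fst h₂).symm)
    · exact tendsto_nhds_unique tendsto_const_nhds h.2
  rw [← key a, ← key b, h]

theorem exists_disjoint_Ioo_of_finite {S : Set ℝ} (hS : S.Finite) (c : ℝ) :
    ∃ δ > 0, Disjoint (Ioo (c - δ) c) S ∧ Disjoint (Ioo c (c + δ)) S := by
  have h : (S \ {c})ᶜ ∈ 𝓝 c :=
    (hS.subset sdiff_subset).isClosed.isOpen_compl.mem_nhds fun h => h.2 rfl
  obtain ⟨δ, hδ, hb⟩ := Metric.mem_nhds_iff.1 h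
  rw [Real.ball_eq_Ioo] at hb
  exact ⟨δ, hδ, disjoint_left.2 fun s hs hsS => hb ⟨hs.1, by linarith [hs.2]⟩ ⟨hsS, hs.2.ne⟩,
    disjoint_left.2 fun s hs hsS => hb ⟨by linarith [hs.1], hs.2⟩ ⟨hsS, hs.1.ne'⟩⟩

theorem differentiableAt_of_piecewise {S : Set ℝ} (hS : S.Finite) {g : ℝ → V}
    (hg : ∀ a b : ℝ, a < b → Disjoint (Ioo a b) S → ContDiffOn ℝ ∞ g (Icc a b)) {s : ℝ}
    (hs : s ∉ S) : DifferentiableAt ℝ g s := by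
  obtain ⟨δ, hδ, hb⟩ := Metric.mem_nhds_iff.1 (hS.isClosed.isOpen_compl.mem_nhds hs)
  rw [Real.ball_eq_Ioo] at hb
  exact ((hg (s - δ) (s + δ) (by linarith) (disjoint_left.2 fun r hr => hb hr)).contDiffAt
    (Icc_mem_nhds (by linarith) (by linarith))).differentiableAt (by simp)

set_option maxHeartbeats 1000000 in
set_option synthInstance.maxHeartbeats 200000 in
-- On a smooth piece the coefficient is continuous, so the equation can be solved in a
-- trivialization and the solution carried back to the bundle. That `δ` is chosen before `p` is what
-- permits the passage to long intervals.
theorem exists_isParallelLift_local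
    (hcov : CovariantDerivative.ContMDiffCovariantDerivative cov ∞)
    {U : Set V} (hU : IsOpen U) {f : V → M} (hf : ContMDiffOn 𝓘(ℝ, V) (𝓡 d) ∞ f U)
    {g : ℝ → V} {a b c : ℝ} (hg : ContDiffOn ℝ ∞ g (Icc a b)) (hab : a < b) (hc : c ∈ Icc a b)
    (hgU : g c ∈ U) :
    ∃ δ > 0, ∀ x y, a ≤ x → x < y → y ≤ b → c ∈ Icc x y → y - x ≤ δ →
      ∀ p : TotalSpace F E, p.proj = f (g y) →
      ∃ u, IsParallelLift cov (fun s => f (g s)) x y u ∧ u y = p := by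
  obtain ⟨r, hr, K, hK, H, hrU, hH, hHK, hrb, hode⟩ := exists_local_ode cov hcov hU hf hgU
  set e := trivializationAt F E (f (g c)) with he
  have hder : ContinuousOn (derivWithin g (Icc a b)) (Icc a b) :=
    hg.continuousOn_derivWithin (uniqueDiffOn_Icc hab) (by simp)
  obtain ⟨C, hC⟩ := isCompact_Icc.exists_bound_of_continuousOn hder
  obtain ⟨δ₁, hδ₁, hδ₁K⟩ := exists_pos_mul_lt (by norm_num : (0 : ℝ) < 1 / 2) (K * C)
  obtain ⟨δ₂, hδ₂, hδ₂g⟩ := Metric.continuousWithinAt_iff.1 (hg.continuousOn c hc) r hr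
  have hC₀ : 0 ≤ C := (norm_nonneg _).trans (hC c hc)
  refine ⟨min δ₁ (δ₂ / 2), lt_min hδ₁ (half_pos hδ₂),
    fun x y hax hxy hyb hcxy hδ p hp => ?_⟩
  have hsub : Icc x y ⊆ Icc a b := Icc_subset_Icc hax hyb
  have hball : ∀ s ∈ Icc x y, g s ∈ Metric.ball (g c) r := fun s hs => by
    refine hδ₂g (hsub hs) ?_
    rw [Real.dist_eq, abs_lt]
    have := hδ.trans (min_le_right _ _)
    constructor <;> linarith [hs.1, hs.2, hcxy.1, hcxy.2]
  -- The one-sided derivative keeps the coefficient continuous up to the ends of the piece, where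
  -- `g` may have a corner.
  let A : ℝ → F →L[ℝ] F := fun s => -H (g s) (derivWithin g (Icc a b) s)
  have hA : ContinuousOn A (Icc x y) :=
    ((hH.comp (hg.continuousOn.mono hsub) hball).clm_apply (hder.mono hsub)).neg
  have hAK : ∀ s ∈ Icc x y, ‖A s‖ ≤ K * C := fun s hs => by
    rw [norm_neg]
    exact (H (g s)).le_of_opNorm_le_of_le (hHK _ (hball s hs)) (hC s (hsub hs))
  have hKC : K * C * (y - x) ≤ 1 / 2 :=
    (mul_le_mul_of_nonneg_left (hδ.trans (min_le_left _ _)) (by positivity)).trans hδ₁K.le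
  obtain ⟨w, hwy, hw⟩ := exists_linear_ode hA (by positivity) hAK hKC
    (right_mem_Icc.2 hxy.le) (e p).2
  have hwc : ContinuousOn w (Icc x y) := fun s hs => (hw s hs).continuousWithinAt
  have hbase : ∀ s ∈ Icc x y, f (g s) ∈ e.baseSet := fun s hs => hrb _ (hball s hs)
  have hew : ∀ s ∈ Icc x y,
      (e (⟨f (g s), e.symm (f (g s)) (w s)⟩ : TotalSpace F E)).2 = w s := fun s hs => by
    rw [Trivialization.apply_mk_symm _ (hbase s hs)]
  refine ⟨fun s => ⟨f (g s), e.symm (f (g s)) (w s)⟩, isParallelLift_iff.2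
    ⟨fun _ => rfl, fun s hs => ?_, ∅, finite_empty, fun s hs => ?_⟩, ?_⟩
  · have hsrc : (⟨f (g s), e.symm (f (g s)) (w s)⟩ : TotalSpace F E) ∈ e.source :=
      e.mem_source.2 (hbase s hs)
    refine (e.tendsto_nhds_iff hsrc).2 ⟨?_, ?_⟩
    · exact ((hf.continuousOn.continuousAt (hU.mem_nhds (hrU (hball s hs)))).comp_continuousWithinAt
        ((hg.continuousOn.mono hsub) s hs))
    · rw [hew s hs]
      refine (hwc s hs).tendsto.congr' ?_
      filter_upwards [self_mem_nhdsWithin] with r hr using (hew r hr).symm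
  · have hsI : s ∈ Icc x y := Ioo_subset_Icc_self hs.1
    have hnhds : Icc x y ∈ 𝓝 s := Icc_mem_nhds hs.1.1 hs.1.2
    have hnhds' : Icc a b ∈ 𝓝 s := Filter.mem_of_superset hnhds hsub
    have hgs : DifferentiableAt ℝ g s := (hg.contDiffAt hnhds').differentiableAt (by simp)
    refine (hode g _ s (fun _ => rfl) (hball s hsI) hgs).2 ?_
    rw [hew s hsI]
    have h₁ : HasDerivAt w ((-H (g s) (deriv g s)) (w s)) s := by
      have h₂ := (hw s hsI).hasDerivAt hnhds
      simp only [A] at h₂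
      rwa [derivWithin_of_mem_nhds hnhds'] at h₂
    refine h₁.congr_of_eventuallyEq ?_
    filter_upwards [hnhds] with r hr using hew r hr
  · have hyI : y ∈ Icc x y := right_mem_Icc.2 hxy.le
    obtain ⟨z, v⟩ := p
    change z = f (g y) at hp
    subst hp
    simp only [hwy]
    rw [e.symm_apply_apply_mk (hbase y hyI)]

/-- A lift must project to `c` on all of `ℝ`, so even over a single point it has to be filled in,
here by zero vectors. -/
theorem exists_isParallelLift_self (c : ℝ → M) (x : ℝ) (p : TotalSpace F E) (hp : p.proj = c x) :
    ∃ u, IsParallelLift cov c x x u ∧ u x = p := by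
  classical
  refine ⟨fun s => if s = x then p else ⟨c s, 0⟩, isParallelLift_iff.2 ⟨fun s => ?_, ?_, ∅,
    finite_empty, fun s hs => ?_⟩, if_pos rfl⟩
  · split_ifs with h
    · rw [hp, h]
    · rfl
  · rw [Icc_self]
    exact continuousOn_singleton _ _
  · exact absurd hs.1 (by simp)

/-- Existence of parallel lifts over piecewise smooth curves with a given end. -/
theorem exists_isParallelLift (hcov : CovariantDerivative.ContMDiffCovariantDerivative cov ∞)
    {U : Set V} (hU : IsOpen U) {f : V → M} (hf : ContMDiffOn 𝓘(ℝ, V) (𝓡 d) ∞ f U)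
    {S : Set ℝ} (hS : S.Finite) {g : ℝ → V}
    (hg : ∀ a b : ℝ, a < b → Disjoint (Ioo a b) S → ContDiffOn ℝ ∞ g (Icc a b))
    (hgU : ∀ s, g s ∈ U) {a b : ℝ} (hab : a ≤ b) :
    ∀ p : TotalSpace F E, p.proj = f (g b) →
      ∃ u, IsParallelLift cov (fun s => f (g s)) a b u ∧ u b = p := by
  refine rel_of_forall_exists_local (R := fun x y => ∀ p : TotalSpace F E, p.proj = f (g y) →
      ∃ u, IsParallelLift cov (fun s => f (g s)) x y u ∧ u y = p) hab
    (fun x y z _ hxy hyz _ h₁ h₂ p hp => ?_) fun c hc => ?_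
  · obtain ⟨u₂, hu₂, hup⟩ := h₂ p hp
    obtain ⟨u₁, hu₁, hu⟩ := h₁ (u₂ y) (hu₂.1 y)
    refine ⟨_, hu₁.glue hu₂ (fun _ _ => rfl) (fun _ _ => rfl) hu, ?_⟩
    split_ifs with h
    · rw [le_antisymm h hyz, hu, ← hup, le_antisymm h hyz]
    · exact hup
  -- The point `c` may be a breakpoint, but the curve is smooth on a short closed interval on either
  -- side of it.
  · obtain ⟨δ, hδ, hl, hr⟩ := exists_disjoint_Ioo_of_finite hS c
    obtain ⟨δ₁, hδ₁, h₁⟩ := exists_isParallelLift_local (cov := cov) hcov hU hf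
      (hg _ _ (by linarith) hl) (by linarith) ⟨by linarith, le_rfl⟩ (hgU c)
    obtain ⟨δ₂, hδ₂, h₂⟩ := exists_isParallelLift_local (cov := cov) hcov hU hf
      (hg _ _ (by linarith) hr) (by linarith) ⟨le_rfl, by linarith⟩ (hgU c)
    refine ⟨min δ (min δ₁ δ₂), by positivity, fun x _ hx => ?_, fun x _ hx => ?_⟩
    · rcases hx.2.eq_or_lt with rfl | hxc
      · exact exists_isParallelLift_self (fun s => f (g s)) _
      · have h₃ := hx.1
        have h₄ : min δ (min δ₁ δ₂) ≤ δ := min_le_left _ _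
        have h₅ : min δ (min δ₁ δ₂) ≤ δ₁ := (min_le_right _ _).trans (min_le_left _ _)
        exact h₁ x c (by linarith) hxc le_rfl ⟨hx.2, le_rfl⟩ (by linarith)
    · rcases hx.1.eq_or_lt with rfl | hxc
      · exact exists_isParallelLift_self (fun s => f (g s)) _
      · have h₃ := hx.2
        have h₄ : min δ (min δ₁ δ₂) ≤ δ := min_le_left _ _
        have h₅ : min δ (min δ₁ δ₂) ≤ δ₂ := (min_le_right _ _).trans (min_le_right _ _)
        exact h₂ c x le_rfl hxc (by linarith) ⟨le_rfl, hx.1⟩ (by linarith)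

end ParallelLift

/-! ### The differential of the fibres -/

section Differential

variable {d : ℕ} {M : Type*} [TopologicalSpace M] [ChartedSpace (EuclideanSpace ℝ (Fin d)) M]
  [IsManifold (𝓡 d) ∞ M]
  {F : ℤ → Type*} [∀ i, NormedAddCommGroup (F i)] [∀ i, NormedSpace ℝ (F i)]
  [∀ i, FiniteDimensional ℝ (F i)]
  {E : ℤ → M → Type*} [∀ i, TopologicalSpace (TotalSpace (F i) (E i))]
  [∀ i x, AddCommGroup (E i x)] [∀ i x, Module ℝ (E i x)] [∀ i x, TopologicalSpace (E i x)]
  [∀ i x, IsTopologicalAddGroup (E i x)] [∀ i x, ContinuousSMul ℝ (E i x)]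
  [∀ i, FiberBundle (F i) (E i)] [∀ i, VectorBundle ℝ (F i) (E i)]

theorem wedgeApply_one_zero {V G₁ G₂ G₃ : Type*} [NormedAddCommGroup V] [NormedSpace ℝ V]
    [NormedAddCommGroup G₁] [NormedSpace ℝ G₁] [NormedAddCommGroup G₂] [NormedSpace ℝ G₂]
    [NormedAddCommGroup G₃] [NormedSpace ℝ G₃]
    (α : V [⋀^Fin 1]→L[ℝ] (G₂ →L[ℝ] G₃)) (β : V [⋀^Fin 0]→L[ℝ] (G₁ →L[ℝ] G₂)) (v : Fin 1 → V) :
    wedgeApply (Nat.add_zero 1) α β v = (α v).comp (β ![]) := by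
  simp only [wedgeApply, Fintype.sum_unique]
  simp
  congr 1
  · exact congrArg α (funext fun k => congrArg v (Subsingleton.elim _ _))
  · exact congrArg β (Subsingleton.elim _ _)

theorem wedgeApply_zero_one {V G₁ G₂ G₃ : Type*} [NormedAddCommGroup V] [NormedSpace ℝ V]
    [NormedAddCommGroup G₁] [NormedSpace ℝ G₁] [NormedAddCommGroup G₂] [NormedSpace ℝ G₂]
    [NormedAddCommGroup G₃] [NormedSpace ℝ G₃]
    (α : V [⋀^Fin 0]→L[ℝ] (G₂ →L[ℝ] G₃)) (β : V [⋀^Fin 1]→L[ℝ] (G₁ →L[ℝ] G₂)) (v : Fin 1 → V) :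
    wedgeApply (Nat.zero_add 1) α β v = (α ![]).comp (β v) := by
  simp only [wedgeApply, Fintype.sum_unique]
  simp
  congr 1
  · exact congrArg α (Subsingleton.elim _ _)
  · exact congrArg β (funext fun k => congrArg v (Subsingleton.elim _ _))

/-- This is `∇A₀ = 0` in coordinates, `dA₀ + Γ A₀ = A₀ Γ`: the component of `D² = 0` of form degree
1. -/
theorem GradedConnection.IsFlat.differential_eq {D : GradedConnection d F E} (hD : D.IsFlat)
    (x₀ : M) (i : ℤ) (v : Fin 1 → EuclideanSpace ℝ (Fin d)) :
    extDeriv (D.localConnection x₀ 0 i (i + 1)) (extChartAt (𝓡 d) x₀ x₀) v +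
      (D.localConnection x₀ 1 (i + 1) (i + 1) (extChartAt (𝓡 d) x₀ x₀) v).comp
        (D.localConnection x₀ 0 i (i + 1) (extChartAt (𝓡 d) x₀ x₀) ![]) =
      (D.localConnection x₀ 0 i (i + 1) (extChartAt (𝓡 d) x₀ x₀) ![]).comp
        (D.localConnection x₀ 1 i i (extChartAt (𝓡 d) x₀ x₀) v) := by
  -- Degrees such as `i + 2 - 1` agree with `i + 1` only propositionally and occur in types; they
  -- are generalized to variables so that they can be substituted.
  have key : ∀ (a b : ℝ) (j₀ j₁ j₂ : ℤ), a = 1 → b = -1 → j₀ = i + 1 → i = j₁ → j₂ = i + 1 →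
      extDeriv (D.localConnection x₀ 0 i j₂) (extChartAt (𝓡 d) x₀ x₀) v +
      (a • wedgeApply (Nat.add_zero 1) (D.localConnection x₀ 1 j₀ j₂ (extChartAt (𝓡 d) x₀ x₀))
          (D.localConnection x₀ 0 i j₀ (extChartAt (𝓡 d) x₀ x₀)) v +
        b • wedgeApply (Nat.zero_add 1) (D.localConnection x₀ 0 j₁ j₂ (extChartAt (𝓡 d) x₀ x₀))
          (D.localConnection x₀ 1 i j₁ (extChartAt (𝓡 d) x₀ x₀)) v) = 0 →
      extDeriv (D.localConnection x₀ 0 i (i + 1)) (extChartAt (𝓡 d) x₀ x₀) v +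
        (D.localConnection x₀ 1 (i + 1) (i + 1) (extChartAt (𝓡 d) x₀ x₀) v).comp
          (D.localConnection x₀ 0 i (i + 1) (extChartAt (𝓡 d) x₀ x₀) ![]) =
        (D.localConnection x₀ 0 i (i + 1) (extChartAt (𝓡 d) x₀ x₀) ![]).comp
          (D.localConnection x₀ 1 i i (extChartAt (𝓡 d) x₀ x₀) v) := by
    rintro a b j₀ j₁ j₂ rfl rfl rfl rfl rfl h
    rw [one_smul, neg_one_smul, wedgeApply_one_zero, wedgeApply_zero_one, ← add_assoc,
      add_neg_eq_zero] at h
    exact h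
  have h := hD x₀ 1 i v
  rw [GradedConnection.curvature, Fin.sum_univ_two] at h
  exact key _ _ _ _ _ (by simp) (by simp) (by simp) (by simp) (by push_cast; ring) h

/-- The operator `A₀` in the trivializations centred at `x₀`. -/
def localDifferential (D : GradedConnection d F E) (x₀ : M) (i : ℤ)
    (y : EuclideanSpace ℝ (Fin d)) : F i →L[ℝ] F (i + 1) :=
  localForm d F (D.form 0 i (i + 1)) x₀ y ![]

theorem localDifferential_differentiableAt (D : GradedConnection d F E) (x₀ : M) (i : ℤ) :
    DifferentiableAt ℝ (localDifferential D x₀ i) (extChartAt (𝓡 d) x₀ x₀) :=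
  ((D.form_smooth 0 i (i + 1) x₀).differentiableAt
    (by simp)).continuousAlternatingMap_apply_const _

theorem localDifferential_apply (D : GradedConnection d F E) {x₀ : M} {i : ℤ}
    {z : TotalSpace (F i) (E i)} (hz : z.proj ∈ (extChartAt (𝓡 d) x₀).source)
    (h₀ : z.proj ∈ (trivializationAt (F i) (E i) x₀).baseSet)
    (h₁ : z.proj ∈ (trivializationAt (F (i + 1)) (E (i + 1)) x₀).baseSet) :
    (trivializationAt (F (i + 1)) (E (i + 1)) x₀ ⟨z.proj, D.differential i z.proj z.2⟩).2 =
      localDifferential D x₀ i (extChartAt (𝓡 d) x₀ z.proj)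
        (trivializationAt (F i) (E i) x₀ z).2 := by
  obtain ⟨x, v⟩ := z
  change x ∈ _ at hz h₀ h₁
  -- `localForm` evaluates the form at the image of `x` under the chart and back, which equals `x`
  -- only propositionally.
  have key : ∀ x', x' = x → (trivializationAt (F (i + 1)) (E (i + 1)) x₀
        ⟨x, D.differential i x v⟩).2 =
      (trivializationAt (F (i + 1)) (E (i + 1)) x₀).continuousLinearMapAt ℝ x'
        (D.form 0 i (i + 1) x' ![] ((trivializationAt (F i) (E i) x₀).symmL ℝ x'
          (trivializationAt (F i) (E i) x₀ ⟨x, v⟩).2)) := by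
    rintro _ rfl
    rw [Trivialization.symmL_apply _ h₀, Trivialization.symm_apply_apply_mk _ h₀,
      Trivialization.continuousLinearMapAt_apply_of_mem ℝ _ h₁]
    rfl
  rw [key _ ((extChartAt (𝓡 d) x₀).left_inv hz)]
  have : ∀ (X : Fin 0 → TangentSpace (𝓡 d) ((extChartAt (𝓡 d) x₀).symm (extChartAt (𝓡 d) x₀ x))),
    ![] = X := fun X => Subsingleton.elim _ _
  simp only [localDifferential, localForm]
  rw [this]
  rfl

/-- The equation `∇A₀ = 0` at the centre of the chart, rewritten for a tangent vector of `M` so that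
it can be applied to the velocity of a curve. -/
theorem GradedConnection.IsFlat.fderiv_localDifferential {D : GradedConnection d F E}
    (hD : D.IsFlat) (x₀ : M) (i : ℤ) (X : TangentSpace (𝓡 d) x₀) (w : F i) :
    fderiv ℝ (localDifferential D x₀ i) (extChartAt (𝓡 d) x₀ x₀)
        (mfderiv (𝓡 d) 𝓘(ℝ, EuclideanSpace ℝ (Fin d)) (extChartAt (𝓡 d) x₀) x₀ X) w +
      connectionForm (D.cov (i + 1)) x₀ x₀ X
        (localDifferential D x₀ i (extChartAt (𝓡 d) x₀ x₀) w) =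
      localDifferential D x₀ i (extChartAt (𝓡 d) x₀ x₀) (connectionForm (D.cov i) x₀ x₀ X w) := by
  let Y : EuclideanSpace ℝ (Fin d) :=
    mfderiv (𝓡 d) 𝓘(ℝ, EuclideanSpace ℝ (Fin d)) (extChartAt (𝓡 d) x₀) x₀ X
  have hY : mfderiv 𝓘(ℝ, EuclideanSpace ℝ (Fin d)) (𝓡 d) (extChartAt (𝓡 d) x₀).symm
      (extChartAt (𝓡 d) x₀ x₀) Y = X := by
    have h := mfderivWithin_extChartAt_symm_comp_mfderiv_extChartAt' (I := 𝓡 d)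
      (mem_extChartAt_source (I := 𝓡 d) x₀)
    rw [ModelWithCorners.range_eq_univ, mfderivWithin_univ] at h
    exact congrArg (fun L => L X) h
  have hB : ∀ j, connectionForm (D.cov j) x₀ x₀ X =
      D.localConnection x₀ 1 j j (extChartAt (𝓡 d) x₀ x₀) fun _ => Y := by
    intro j
    have key : ∀ x', x' = x₀ → ∀ Z : EuclideanSpace ℝ (Fin d),
        connectionForm (D.cov j) x₀ x' Z = connectionForm (D.cov j) x₀ x₀ Z := by
      rintro x' rfl Z
      rfl
    simp only [GradedConnection.localConnection, dif_pos]
    refine ((key _ (extChartAt_to_inv (I := 𝓡 d) x₀) X).symm.trans ?_)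
    exact congrArg (connectionForm (D.cov j) x₀ _) hY.symm
  have h := congrArg (fun L => L w) (hD.differential_eq x₀ i fun _ => Y)
  have hext : extDeriv (D.localConnection x₀ 0 i (i + 1)) (extChartAt (𝓡 d) x₀ x₀) (fun _ => Y) =
      fderiv ℝ (localDifferential D x₀ i) (extChartAt (𝓡 d) x₀ x₀) Y := by
    refine (extDeriv_apply ((D.form_smooth 0 i (i + 1) x₀).differentiableAt (by simp)) _).trans ?_
    refine (Fin.sum_univ_one _).trans ?_
    rw [Fin.val_zero, pow_zero, one_smul]
    refine congrArg (fun B => fderiv ℝ B (extChartAt (𝓡 d) x₀ x₀) Y) (funext fun y => ?_)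
    exact congrArg (localForm d F (D.form 0 i (i + 1)) x₀ y) (Subsingleton.elim _ _)
  rw [hext] at h
  rw [hB, hB]
  exact h

variable {c : ℝ → M} {a b : ℝ} {i : ℤ} {u : ℝ → TotalSpace (F i) (E i)}

theorem eventually_localDifferential_apply (D : GradedConnection d F E) (x₀ : M) (i : ℤ) :
    ∀ᶠ x in 𝓝 x₀, ∀ v : E i x,
      (trivializationAt (F (i + 1)) (E (i + 1)) x₀ ⟨x, D.differential i x v⟩).2 =
      localDifferential D x₀ i (extChartAt (𝓡 d) x₀ x) (trivializationAt (F i) (E i) x₀ ⟨x, v⟩).2 := by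
  filter_upwards [extChartAt_source_mem_nhds (I := 𝓡 d) x₀,
    (trivializationAt (F i) (E i) x₀).open_baseSet.mem_nhds
      (mem_baseSet_trivializationAt _ _ x₀),
    (trivializationAt (F (i + 1)) (E (i + 1)) x₀).open_baseSet.mem_nhds
      (mem_baseSet_trivializationAt _ _ x₀)] with x h h₀ h₁ v
  exact localDifferential_apply D (z := ⟨x, v⟩) h h₀ h₁

/-- The differential of the fibres of a flat graded connection is parallel. -/
theorem IsParallelLift.differential {D : GradedConnection d F E} (hD : D.IsFlat)
    (hu : IsParallelLift (D.cov i) c a b u) :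
    IsParallelLift (D.cov (i + 1)) c a b
      fun s => ⟨(u s).proj, D.differential i (u s).proj (u s).2⟩ := by
  obtain ⟨h₁, h₂, S, hS, h₃⟩ := isParallelLift_iff.1 hu
  refine isParallelLift_iff.2 ⟨h₁, fun s hs => ?_, S, hS, fun s hs => ?_⟩
  · have hsrc : ∀ j, ∀ z : TotalSpace (F j) (E j), z ∈ (trivializationAt (F j) (E j) z.proj).source :=
      fun j z => (Trivialization.mem_source _).2 (mem_baseSet_trivializationAt _ _ _)
    have hus := ((trivializationAt (F i) (E i) (u s).proj).tendsto_nhds_iff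
      (hsrc i (u s))).1 (h₂ s hs)
    refine ((trivializationAt (F (i + 1)) (E (i + 1)) (u s).proj).tendsto_nhds_iff
      (hsrc (i + 1) ⟨(u s).proj, _⟩)).2 ⟨hus.1, ?_⟩
    have hev := eventually_localDifferential_apply D (u s).proj i
    rw [hev.self_of_nhds]
    have hB : Filter.Tendsto (fun r => localDifferential D (u s).proj i
        (extChartAt (𝓡 d) (u s).proj (u r).proj)) (𝓝[Icc a b] s)
        (𝓝 (localDifferential D (u s).proj i (extChartAt (𝓡 d) (u s).proj (u s).proj))) :=
      (localDifferential_differentiableAt D (u s).proj i).continuousAt.tendsto.comp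
      ((continuousAt_extChartAt (I := 𝓡 d) (u s).proj).tendsto.comp hus.1)
    refine ((isBoundedBilinearMap_apply.continuous.tendsto _).comp (hB.prodMk_nhds hus.2)).congr' ?_
    filter_upwards [hus.1.eventually hev] with r hr using (hr (u r).2).symm
  · obtain ⟨hc, h⟩ := h₃ s hs
    have hev := eventually_localDifferential_apply D (c s) i
    have hcev := hc.continuousAt.eventually hev
    refine ⟨hc, ?_⟩
    have hφ := (mdifferentiableAt_extChartAt (I := 𝓡 d)
      (mem_chart_source _ (c s))).hasDerivAt_comp_curve hc
    have hB := (localDifferential_differentiableAt D (c s) i).hasFDerivAt.comp_hasDerivAt s hφ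
    have hd := hB.clm_apply h
    have heq : ∀ᶠ r in 𝓝 s, (trivializationAt (F (i + 1)) (E (i + 1)) (c s)
        ⟨(u r).proj, D.differential i (u r).proj (u r).2⟩).2 =
        localDifferential D (c s) i (extChartAt (𝓡 d) (c s) (c r))
          (trivializationAt (F i) (E i) (c s) (u r)).2 := by
      filter_upwards [hcev] with r hr
      rw [← h₁ r] at hr
      refine (hr _).trans ?_
      exact congrArg (fun x => localDifferential D (c s) i (extChartAt (𝓡 d) (c s) x)
        (trivializationAt (F i) (E i) (c s) (u r)).2) (h₁ r)
    refine (hd.congr_of_eventuallyEq heq).congr_deriv ?_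
    rw [heq.self_of_nhds, map_neg]
    -- The product rule gives `(A₀ u)' = dA₀(c') u - A₀ Γ(c') u`, which `∇A₀ = 0` turns into `-Γ(c')
    -- A₀ u`.
    have hflat := hD.fderiv_localDifferential (c s) i (mfderiv 𝓘(ℝ, ℝ) (𝓡 d) c s (1 : ℝ))
      (trivializationAt (F i) (E i) (c s) (u s)).2
    exact add_neg_eq_iff_eq_add.2 ((neg_add_eq_of_eq_add (hflat.symm.trans (add_comm _ _))).symm)

end Differential

/-! ### Parallel transport along the paths in simplices -/

section ParallelTransport

variable {d : ℕ} {M : Type*} [TopologicalSpace M] [ChartedSpace (EuclideanSpace ℝ (Fin d)) M]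
  [IsManifold (𝓡 d) ∞ M]
  {F : Type*} [NormedAddCommGroup F] [NormedSpace ℝ F] [FiniteDimensional ℝ F]
  {E : M → Type*} [TopologicalSpace (TotalSpace F E)]
  [∀ x, AddCommGroup (E x)] [∀ x, Module ℝ (E x)] [∀ x, TopologicalSpace (E x)]
  [∀ x, IsTopologicalAddGroup (E x)] [∀ x, ContinuousSMul ℝ (E x)]
  [FiberBundle F E] [VectorBundle ℝ F E] {cov : CovariantDerivative (𝓡 d) F E}

theorem nonempty_fibre_equiv (F : Type*) [NormedAddCommGroup F] [NormedSpace ℝ F]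
    (E : M → Type*) [TopologicalSpace (TotalSpace F E)]
    [∀ x, AddCommGroup (E x)] [∀ x, Module ℝ (E x)] [∀ x, TopologicalSpace (E x)]
    [FiberBundle F E] [VectorBundle ℝ F E] (x : M) : Nonempty (E x ≃L[ℝ] F) :=
  ⟨(trivializationAt F E x).continuousLinearEquivAt ℝ x (mem_baseSet_trivializationAt F E x)⟩

/-- Casts between equal fibres disappear in the total space, so the face identities are checked
there. -/
theorem totalSpace_mk_fibreCast {x y : M} (h : x = y) (v : E x) :
    (⟨y, fibreCast h v⟩ : TotalSpace F E) = ⟨x, v⟩ := by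
  subst h
  rfl

theorem IsParallelLift.exists_section {c : ℝ → M} {a b : ℝ} {u : ℝ → TotalSpace F E}
    (hu : IsParallelLift cov c a b u) :
    ∃ U : ∀ s, E (c s), u = fun s => ⟨c s, U s⟩ :=
  ⟨fun s => fibreCast (hu.1 s) (u s).2, funext fun _ => (totalSpace_mk_fibreCast _ _).symm⟩

/-- Parallel transport exists if parallel lifts exist and are unique. -/
theorem exists_isParallelTransport {c : ℝ → M} {ℓ : ℝ} {x y : M} (hx : c 0 = x) (hy : c ℓ = y)
    (hex : ∀ p : TotalSpace F E, p.proj = c ℓ → ∃ u, IsParallelLift cov c 0 ℓ u ∧ u ℓ = p)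
    (huniq : ∀ u u' : ℝ → TotalSpace F E, IsParallelLift cov c 0 ℓ u →
      IsParallelLift cov c 0 ℓ u' → (u 0 = u' 0 ↔ u ℓ = u' ℓ)) :
    ∃ P : E y ≃L[ℝ] E x, IsParallelTransport cov c ℓ P := by
  subst hx hy
  have hex' : ∀ v : E (c ℓ), ∃ U : ∀ s, E (c s),
      IsParallelLift cov c 0 ℓ (fun s => ⟨c s, U s⟩) ∧ U ℓ = v := by
    intro v
    obtain ⟨u, hu, huv⟩ := hex ⟨c ℓ, v⟩ rfl
    obtain ⟨U, rfl⟩ := hu.exists_section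
    exact ⟨U, hu, TotalSpace.mk_injective _ huv⟩
  choose U hU hUv using hex'
  have hinj : ∀ (V W : ∀ s, E (c s)), IsParallelLift cov c 0 ℓ (fun s => ⟨c s, V s⟩) →
      IsParallelLift cov c 0 ℓ (fun s => ⟨c s, W s⟩) → (V 0 = W 0 ↔ V ℓ = W ℓ) := by
    intro V W hV hW
    have h := huniq _ _ hV hW
    rwa [(TotalSpace.mk_injective (c 0)).eq_iff, (TotalSpace.mk_injective (c ℓ)).eq_iff] at h
  have hlin : ∀ (r : ℝ) (v w : E (c ℓ)), U (r • v + w) 0 = r • U v 0 + U w 0 := fun r v w => by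
    refine (hinj _ _ (hU _) ((hU v).smul_add (hU w) r)).2 ?_
    simp only [hUv]
  have hlin₀ : U 0 0 = 0 := by
    have h := hlin 1 0 0
    simpa using h
  let P : E (c ℓ) →ₗ[ℝ] E (c 0) :=
    { toFun := fun v => U v 0
      map_add' := fun v w => by simpa using hlin 1 v w
      map_smul' := fun r v => by simpa [hlin₀] using hlin r v 0 }
  have hPinj : Function.Injective P := fun v w h => by
    rw [← hUv v, ← hUv w]
    exact (hinj _ _ (hU _) (hU _)).1 h
  obtain ⟨e₀⟩ := nonempty_fibre_equiv F E (c 0)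
  obtain ⟨e₁⟩ := nonempty_fibre_equiv F E (c ℓ)
  have : FiniteDimensional ℝ (E (c 0)) := e₀.symm.toLinearEquiv.finiteDimensional
  have : FiniteDimensional ℝ (E (c ℓ)) := e₁.symm.toLinearEquiv.finiteDimensional
  have : T2Space (E (c 0)) := e₀.toHomeomorph.isEmbedding.t2Space
  have : T2Space (E (c ℓ)) := e₁.toHomeomorph.isEmbedding.t2Space
  -- Both fibres are modelled on `F`, so injectivity, which follows from uniqueness of lifts,
  -- already gives an isomorphism.
  have hrank : Module.finrank ℝ (E (c ℓ)) = Module.finrank ℝ (E (c 0)) :=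
    (e₁.trans e₀.symm).toLinearEquiv.finrank_eq
  refine ⟨(LinearEquiv.ofInjectiveOfFinrankEq P hPinj hrank).toContinuousLinearEquiv, fun v => ?_⟩
  exact ⟨_, hU v, rfl, by rw [hUv]⟩

theorem IsParallelTransport.apply_eq {c : ℝ → M} {ℓ : ℝ} {x y : M} {P : E y → E x}
    (hP : IsParallelTransport cov c ℓ P)
    (huniq : ∀ u u' : ℝ → TotalSpace F E, IsParallelLift cov c 0 ℓ u →
      IsParallelLift cov c 0 ℓ u' → (u 0 = u' 0 ↔ u ℓ = u' ℓ))
    {u : ℝ → TotalSpace F E} (hu : IsParallelLift cov c 0 ℓ u) {v : E y} {w : E x}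
    (h₀ : u 0 = ⟨x, w⟩) (h₁ : u ℓ = ⟨y, v⟩) : P v = w := by
  obtain ⟨u', hu', h₀', h₁'⟩ := hP v
  refine TotalSpace.mk_injective (F := F) x ?_
  rw [← h₀, ← h₀']
  exact (huniq _ _ hu' hu).2 (h₁'.trans h₁.symm)

variable [ContMDiffVectorBundle ∞ F E (𝓡 d)] [T2Space M]

theorem Simp.exists_extension {k : ℕ} (σ : (Simp d M).obj (op ⦋k⦌)) :
    ∃ (U : Set (Fin (k + 1) → ℝ)) (f : (Fin (k + 1) → ℝ) → M), IsOpen U ∧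
      ContMDiffOn 𝓘(ℝ, Fin (k + 1) → ℝ) (𝓡 d) ∞ f U ∧
      (∀ x : stdSimplex ℝ (Fin (k + 1)), (x : Fin (k + 1) → ℝ) ∈ U) ∧
      ∀ x : stdSimplex ℝ (Fin (k + 1)), Simp.eval σ x = f x := by
  obtain ⟨U, f, hU, hΔ, hf, hfσ⟩ := SmoothSimplex.smooth (k := k) σ
  exact ⟨U, f, hU, hf, fun x => hΔ x.2, fun x => (hfσ x).symm⟩

/-- The curve `σ ∘ γ_k(t)`. -/
abbrev Simp.curve {k : ℕ} (σ : (Simp d M).obj (op ⦋k⦌)) (t : Fin (k - 1) → unitInterval)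
    (s : ℝ) : M :=
  Simp.eval σ ((simplexPathFamily.path k t).toFun s)

theorem exists_countable_differentiableAt_pathOfCube (k : ℕ) (t : Fin (k - 1) → unitInterval) :
    ∃ S : Set ℝ, S.Countable ∧ ∀ s ∉ S,
      DifferentiableAt ℝ (fun s => ((pathOfCube k t).toFun s : Fin (k + 1) → ℝ)) s := by
  obtain ⟨S, hS, h⟩ := (pathOfCube k t).piecewise_smooth
  exact ⟨S, hS.countable, fun s hs => differentiableAt_of_piecewise hS h hs⟩

theorem Simp.exists_isParallelLift
    (hcov : CovariantDerivative.ContMDiffCovariantDerivative cov ∞) {k : ℕ}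
    (σ : (Simp d M).obj (op ⦋k⦌)) (t : Fin (k - 1) → unitInterval) {a b : ℝ} (hab : a ≤ b)
    (p : TotalSpace F E) (hp : p.proj = Simp.curve σ t b) :
    ∃ u, IsParallelLift cov (Simp.curve σ t) a b u ∧ u b = p := by
  obtain ⟨U, f, hU, hf, hmem, heval⟩ := Simp.exists_extension σ
  obtain ⟨S, hS, h⟩ := (simplexPathFamily.path k t).piecewise_smooth
  have hc : Simp.curve σ t = fun s => f ((simplexPathFamily.path k t).toFun s) :=
    funext fun s => heval _
  rw [hc] at hp ⊢
  exact _root_.exists_isParallelLift hcov hU hf hS h (fun s => hmem _) hab p hp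

theorem Simp.isParallelLift_eq_iff
    (hcov : CovariantDerivative.ContMDiffCovariantDerivative cov ∞) {k : ℕ}
    (σ : (Simp d M).obj (op ⦋k⦌)) (t : Fin (k - 1) → unitInterval) {a b : ℝ} (hab : a ≤ b)
    (u u' : ℝ → TotalSpace F E) (hu : IsParallelLift cov (Simp.curve σ t) a b u)
    (hu' : IsParallelLift cov (Simp.curve σ t) a b u') : u a = u' a ↔ u b = u' b := by
  obtain ⟨U, f, hU, hf, hmem, heval⟩ := Simp.exists_extension σ
  have hc : Simp.curve σ t = fun s => f ((simplexPathFamily.path k t).toFun s) :=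
    funext fun s => heval _
  rw [hc] at hu hu'
  exact IsParallelLift.eq_iff hcov hU hf (lipschitzWith_pathOfCube k t) (fun s => hmem _)
    (exists_countable_differentiableAt_pathOfCube k t) hab hu hu'

theorem Simp.curve_zero {k : ℕ} (σ : (Simp d M).obj (op ⦋k⦌)) (t : Fin (k - 1) → unitInterval) :
    Simp.curve σ t 0 = Simp.vertex σ 0 :=
  congrArg (Simp.eval σ) (simplexPathFamily.source k t)

theorem Simp.curve_length {k : ℕ} (σ : (Simp d M).obj (op ⦋k⦌))
    (t : Fin (k - 1) → unitInterval) :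
    Simp.curve σ t (simplexPathFamily.path k t).length = Simp.vertex σ (Fin.last k) :=
  congrArg (Simp.eval σ) (simplexPathFamily.target k t)

theorem Simp.exists_isParallelTransport
    (hcov : CovariantDerivative.ContMDiffCovariantDerivative cov ∞) {k : ℕ}
    (σ : (Simp d M).obj (op ⦋k⦌)) (t : Fin (k - 1) → unitInterval) :
    ∃ P : E (Simp.vertex σ (Fin.last k)) ≃L[ℝ] E (Simp.vertex σ 0),
      IsParallelTransport cov (Simp.curve σ t) (simplexPathFamily.path k t).length P :=
  _root_.exists_isParallelTransport (Simp.curve_zero σ t) (Simp.curve_length σ t)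
    (Simp.exists_isParallelLift hcov σ t (SimplexPath.length_nonneg _))
    (Simp.isParallelLift_eq_iff hcov σ t (SimplexPath.length_nonneg _))

/-- The parallel transport along the curve `σ ∘ γ_k(t)`. -/
def Simp.transport (hcov : CovariantDerivative.ContMDiffCovariantDerivative cov ∞) {k : ℕ}
    (σ : (Simp d M).obj (op ⦋k⦌)) (t : Fin (k - 1) → unitInterval) :
    E (Simp.vertex σ (Fin.last k)) ≃L[ℝ] E (Simp.vertex σ 0) :=
  (Simp.exists_isParallelTransport hcov σ t).choose

theorem Simp.isParallelTransport_transport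
    (hcov : CovariantDerivative.ContMDiffCovariantDerivative cov ∞) {k : ℕ}
    (σ : (Simp d M).obj (op ⦋k⦌)) (t : Fin (k - 1) → unitInterval) :
    IsParallelTransport cov (Simp.curve σ t) (simplexPathFamily.path k t).length
      (Simp.transport hcov σ t) :=
  (Simp.exists_isParallelTransport hcov σ t).choose_spec

/-- The face identities on cube faces and the commutation with `A₀` are proved by exhibiting one
parallel lift with the required ends. -/
theorem Simp.transport_eq (hcov : CovariantDerivative.ContMDiffCovariantDerivative cov ∞) {k : ℕ}
    (σ : (Simp d M).obj (op ⦋k⦌)) (t : Fin (k - 1) → unitInterval) {u : ℝ → TotalSpace F E}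
    (hu : IsParallelLift cov (Simp.curve σ t) 0 (simplexPathFamily.path k t).length u)
    {v : E (Simp.vertex σ (Fin.last k))} {w : E (Simp.vertex σ 0)}
    (h₀ : u 0 = ⟨_, w⟩) (h₁ : u (simplexPathFamily.path k t).length = ⟨_, v⟩) :
    Simp.transport hcov σ t v = w :=
  (Simp.isParallelTransport_transport hcov σ t).apply_eq
    (Simp.isParallelLift_eq_iff hcov σ t (SimplexPath.length_nonneg _)) hu h₀ h₁

/-- All lifts are prolonged by constants to `[0, L]`. Their values at `L` depend continuously on the
data, hence so do their values at 0. -/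
theorem Simp.continuous_transport
    (hcov : CovariantDerivative.ContMDiffCovariantDerivative cov ∞) {k : ℕ}
    (σ : (Simp d M).obj (op ⦋k⦌)) :
    Continuous fun tv : (Fin (k - 1) → unitInterval) × E (Simp.vertex σ (Fin.last k)) =>
      Simp.transport hcov σ tv.1 tv.2 := by
  obtain ⟨e⟩ := nonempty_fibre_equiv F E (Simp.vertex σ (Fin.last k))
  -- Makes the neighbourhood filter of `q₀` countably generated, as dominated convergence requires.
  have : FirstCountableTopology (E (Simp.vertex σ (Fin.last k))) :=
    e.toHomeomorph.isInducing.firstCountableTopology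
  obtain ⟨U, f, hU, hf, hmem, heval⟩ := Simp.exists_extension σ
  obtain ⟨L, hL⟩ := exists_length_le_pathOfCube k
  have hL₀ : 0 ≤ L := (SimplexPath.length_nonneg _).trans (hL fun _ => 0)
  have hc : ∀ t, Simp.curve σ t = fun s => f ((pathOfCube k t).toFun s) :=
    fun t => funext fun s => heval _
  have hex : ∀ q : (Fin (k - 1) → unitInterval) × E (Simp.vertex σ (Fin.last k)),
      ∃ u : ℝ → TotalSpace F E, IsParallelLift cov (Simp.curve σ q.1) 0 L u ∧
        u 0 = ⟨_, Simp.transport hcov σ q.1 q.2⟩ ∧ u L = ⟨_, q.2⟩ := by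
    intro q
    obtain ⟨u, hu, hu₀, hu₁⟩ := Simp.isParallelTransport_transport hcov σ q.1 q.2
    obtain ⟨u', hu', hu₀', hu₁'⟩ := hu.exists_extend (SimplexPath.length_nonneg _)
      (fun s hs => congrArg (Simp.eval σ) (SimplexPath.eq_target _ s hs)) L
    exact ⟨u', hu', hu₀'.trans hu₀, (hu₁' L (hL q.1)).trans hu₁⟩
  choose u hu hu₀ hu₁ using hex
  refine continuous_iff_continuousAt.2 fun q₀ => ?_
  obtain ⟨S, hS, hS'⟩ := tendsto_deriv_pathOfCube k q₀.1
  have hfst : Filter.Tendsto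
      (fun q : (Fin (k - 1) → unitInterval) × E (Simp.vertex σ (Fin.last k)) => q.1) (𝓝 q₀)
      (𝓝 q₀.1) := continuous_fst.tendsto _
  have h := tendsto_parallelLift_iff hcov hU hf (l := 𝓝 q₀)
    (g := fun q s => ((pathOfCube k q.1).toFun s : Fin (k + 1) → ℝ))
    (fun q => lipschitzWith_pathOfCube k q.1) (lipschitzWith_pathOfCube k q₀.1) (fun s => hmem _)
    (fun q => exists_countable_differentiableAt_pathOfCube k q.1)
    (exists_countable_differentiableAt_pathOfCube k q₀.1)
    (fun s => ?_) ⟨S, hS.countable, fun s hs => (hS' s hs).comp hfst⟩ hL₀ (u := u) (u₀ := u q₀)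
    (fun q => by rw [← hc]; exact hu q) (by rw [← hc]; exact hu q₀)
  · simp only [hu₀, hu₁] at h
    refine ((FiberBundle.totalSpaceMk_isInducing F E _).tendsto_nhds_iff).2 (h.2 ?_)
    exact ((FiberBundle.continuous_totalSpaceMk F E _).tendsto _).comp (continuous_snd.tendsto q₀)
  · have h₁ := (simplexPathFamily.continuous_path k).comp
      ((continuous_fst (X := Fin (k - 1) → unitInterval)
        (Y := E (Simp.vertex σ (Fin.last k)))).prodMk (continuous_const (y := s)))
    exact (continuous_subtype_val.comp h₁).tendsto q₀

theorem Simp.transport_point (hcov : CovariantDerivative.ContMDiffCovariantDerivative cov ∞)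
    (σ : (Simp d M).obj (op ⦋0⦌)) (t : Fin (0 - 1) → unitInterval) (v : E (Simp.vertex σ 0)) :
    Simp.transport hcov σ t v = v := by
  obtain ⟨u, -, hu₀, hu₁⟩ := Simp.isParallelTransport_transport hcov σ t v
  rw [simplexPathFamily.point t] at hu₁
  exact TotalSpace.mk_injective (F := F) _ (hu₀.symm.trans hu₁)

theorem Simp.transport_face_zero
    (hcov : CovariantDerivative.ContMDiffCovariantDerivative cov ∞) {n : ℕ}
    (σ : (Simp d M).obj (op ⦋n + 2⦌)) (p : Fin (n + 1)) (t : Fin (n + 1) → unitInterval)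
    (v : E (Simp.vertex σ (Fin.last (n + 2)))) (ht : t p = 0) :
    Simp.transport hcov σ t v = fibreCast (Simp.vertex_restrict_eq σ (faceMap_zero p))
      (Simp.transport hcov (Simp.restrict (faceMap p.succ.castSucc) σ) (p.removeNth t)
        (fibreCast (Simp.vertex_restrict_eq σ (faceMap_last p)).symm v)) := by
  obtain ⟨u, hu, hu₀, hu₁⟩ := Simp.isParallelTransport_transport hcov
    (Simp.restrict (faceMap p.succ.castSucc) σ) (p.removeNth t)
    (fibreCast (Simp.vertex_restrict_eq σ (faceMap_last p)).symm v)
  obtain ⟨hlen, hpath⟩ := simplexPathFamily.face_zero n p t ht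
  have hc : Simp.curve σ t =
      Simp.curve (Simp.restrict (faceMap p.succ.castSucc) σ) (p.removeNth t) :=
    funext fun s => congrArg (Simp.eval σ) (hpath s)
  refine Simp.transport_eq hcov σ t (u := u) ?_ ?_ ?_
  · rw [hc, hlen]
    exact hu
  · rw [totalSpace_mk_fibreCast]
    exact hu₀
  · rw [hlen]
    exact hu₁.trans (totalSpace_mk_fibreCast _ _)

theorem Simp.transport_face_one
    (hcov : CovariantDerivative.ContMDiffCovariantDerivative cov ∞) {a b : ℕ}
    (σ : (Simp d M).obj (op ⦋a + 1 + (b + 1)⦌)) (t : Fin a → unitInterval)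
    (t' : Fin b → unitInterval) (v : E (Simp.vertex σ (Fin.last (a + 1 + (b + 1))))) :
    Simp.transport hcov σ (Fin.append (Fin.snoc t 1 : Fin (a + 1) → unitInterval) t') v =
      fibreCast (Simp.vertex_restrict_eq σ (frontMap_zero a b))
        (Simp.transport hcov (Simp.restrict (frontMap a b) σ) t
          (fibreCast ((Simp.vertex_restrict_eq σ rfl).trans
              (Simp.vertex_restrict_eq σ (frontMap_last a b)).symm)
            (Simp.transport hcov (Simp.restrict (backMap a b) σ) t'
              (fibreCast (Simp.vertex_restrict_eq σ (backMap_last a b)).symm v)))) := by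
  obtain ⟨u₂, hu₂, hu₂₀, hu₂₁⟩ := Simp.isParallelTransport_transport hcov
    (Simp.restrict (backMap a b) σ) t'
    (fibreCast (Simp.vertex_restrict_eq σ (backMap_last a b)).symm v)
  obtain ⟨u₁, hu₁, hu₁₀, hu₁₁⟩ := Simp.isParallelTransport_transport hcov
    (Simp.restrict (frontMap a b) σ) t
    (fibreCast ((Simp.vertex_restrict_eq σ rfl).trans
      (Simp.vertex_restrict_eq σ (frontMap_last a b)).symm)
      (Simp.transport hcov (Simp.restrict (backMap a b) σ) t'
        (fibreCast (Simp.vertex_restrict_eq σ (backMap_last a b)).symm v)))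
  obtain ⟨hlen, hpath₁, hpath₂⟩ := simplexPathFamily.face_one a b t t'
  have h₁ := (simplexPathFamily.path (a + 1) t).length_nonneg
  have h₂ := (simplexPathFamily.path (b + 1) t').length_nonneg
  rw [totalSpace_mk_fibreCast] at hu₁₁
  -- The back lift is delayed by the length of the front path and glued to the front lift.
  have hu₂s := hu₂.comp_sub_const (simplexPathFamily.path (a + 1) t).length
  rw [zero_add, add_comm (SimplexPath.length _)] at hu₂s
  have hglue := hu₁.glue (c := Simp.curve σ (Fin.append (Fin.snoc t 1 : Fin (a + 1) → unitInterval) t'))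
    hu₂s (fun s hs => congrArg (Simp.eval σ) (hpath₁ s hs))
    (fun s hs => congrArg (Simp.eval σ) (hpath₂ s hs)) (by rw [sub_self, hu₁₁, hu₂₀])
  refine Simp.transport_eq hcov σ _ (by rw [hlen]; exact hglue) ?_ ?_
  · rw [if_pos h₁, totalSpace_mk_fibreCast]
    exact hu₁₀
  · rw [hlen]
    split_ifs with h
    -- At the final time the first branch could apply only if the back path had length zero, and
    -- then both branches agree.
    · have h₃ : (simplexPathFamily.path (b + 1) t').length = 0 := by linarith
      rw [h₃] at hu₂₁ ⊢
      rw [add_zero, hu₁₁, ← hu₂₀, hu₂₁, totalSpace_mk_fibreCast]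
    · rw [add_sub_cancel_left, hu₂₁, totalSpace_mk_fibreCast]

end ParallelTransport

end

/-! ### Assembly of the representation up to homotopy -/

theorem mainTheorem1 :
    ∃ γ : SimplexPathFamily,
      ∀ (d : ℕ) (M : Type*) [TopologicalSpace M] [T2Space M]
        [ChartedSpace (EuclideanSpace ℝ (Fin d)) M] [IsManifold (𝓡 d) ∞ M]
        (F : ℤ → Type*) [∀ i, NormedAddCommGroup (F i)] [∀ i, NormedSpace ℝ (F i)]
        [∀ i, FiniteDimensional ℝ (F i)]
        (E : ℤ → M → Type*) [∀ i, TopologicalSpace (TotalSpace (F i) (E i))]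
        [∀ i x, AddCommGroup (E i x)] [∀ i x, Module ℝ (E i x)]
        [∀ i x, TopologicalSpace (E i x)] [∀ i x, IsTopologicalAddGroup (E i x)]
        [∀ i x, ContinuousSMul ℝ (E i x)] [∀ i, FiberBundle (F i) (E i)]
        [∀ i, VectorBundle ℝ (F i) (E i)] [∀ i, ContMDiffVectorBundle ∞ (F i) (E i) (𝓡 d)]
        (D : GradedConnection d F E), D.IsFlat →
        ∃ θ : RepUpToHomotopy d E,
          (∀ (k : ℕ) (σ : (Simp d M).obj (op ⦋k⦌)) (t : Fin (k - 1) → unitInterval) (i : ℤ),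
            IsParallelTransport (D.cov i)
              (fun s => Simp.eval σ ((γ.path k t).toFun s))
              (γ.path k t).length (θ.θ k σ t i)) ∧
          ∀ (k : ℕ) (σ : (Simp d M).obj (op ⦋k⦌)) (t : Fin (k - 1) → unitInterval) (i : ℤ)
            (v : E i (Simp.vertex σ (Fin.last k))),
            θ.θ k σ t (i + 1) (D.differential i (Simp.vertex σ (Fin.last k)) v) =
              D.differential i (Simp.vertex σ 0) (θ.θ k σ t i v) := by
  refine ⟨simplexPathFamily, ?_⟩
  intro d M _ _ _ _ F _ _ _ E _ _ _ _ _ _ _ _ _ D hD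
  refine ⟨{ θ := fun k σ t i => Simp.transport (D.cov_smooth i) σ t
            continuous_θ := fun k σ i => Simp.continuous_transport (D.cov_smooth i) σ
            point := fun σ t i v => Simp.transport_point (D.cov_smooth i) σ t v
            face_zero := fun n σ p t i v ht =>
              Simp.transport_face_zero (D.cov_smooth i) σ p t v ht
            face_one := fun a b σ t t' i v =>
              Simp.transport_face_one (D.cov_smooth i) σ t t' v }, ?_, ?_⟩
  · exact fun k σ t i => Simp.isParallelTransport_transport (D.cov_smooth i) σ t
  · intro k σ t i v
    obtain ⟨u, hu, hu₀, hu₁⟩ := Simp.isParallelTransport_transport (D.cov_smooth i) σ t v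
    -- Applying `A₀` to the lift `u` gives a parallel lift in degree `i + 1` whose ends are the
    -- images of the ends of `u`.
    refine Simp.transport_eq (D.cov_smooth (i + 1)) σ t (hu.differential hD) ?_ ?_
    · rw [hu₀]
    · rw [hu₁]
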